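/- Let $W^s,W^v$ be standard Brownian motions on a probability space with instantaneous correlation $\rho_{sv}$, i.e. jointly Gaussian with $\mathrm{Cov}(W^s_u,W^v_t)=\rho_{sv}\min(u,t)$ for all $u,t\ge 0$. Let $\lambda_s,\mu_s,\sigma_s,\mu_v,\beta_v,\gamma_v,\sigma_v,S_0,V_0$ be real constants, and let $(S_t)_{t\ge0},(V_t)_{t\ge0}$ be processes with continuous paths and deterministic initial values $S_0,V_0$ that solve $$dS_t=\lambda_s(\mu_s-S_t)\,dt+\sigma_s\,dW^s_t,\qquad dV_t=\bigl(\mu_v+\beta_v(S_t-\mu_s)^2-\gamma_vV_t\bigr)\,dt+\sigma_v\,dW^v_t .$$ Then for every $t\ge0$ the variables $S_t$ and $V_t$ are square integrable, and each of the following formulas holds whenever the denominator that appears in it is nonzero: $$\mathbb E[S_t]=e^{-\lambda_s t}\left(S_0+\mu_s(e^{\lambda_s t}-1)\right),$$ $$\begin{aligned}\mathbb E[V_t]=\frac{e^{-(\gamma_v+2\lambda_s)t}}{2\gamma_v\lambda_s(\gamma_v-2\lambda_s)}\Bigl[&\beta_v\gamma_ve^{\gamma_vt}\left(2\lambda_s\mu_s^2+2\lambda_sS_0^2-4\lambda_s\mu_sS_0-\sigma_s^2\right)\\&-2\lambda_se^{2\lambda_st}\left(\beta_v\gamma_v\mu_s^2-\beta_v\sigma_s^2+\gamma_v\mu_v-2\lambda_s\mu_v+\beta_v\gamma_vS_0^2-2\beta_v\gamma_v\mu_sS_0-\gamma_vV_0(\gamma_v-2\lambda_s)\right)\\&+(\gamma_v-2\lambda_s)e^{(\gamma_v+2\lambda_s)t}\left(\beta_v\sigma_s^2+2\lambda_s\mu_v\right)\Bigr],\end{aligned}$$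 $$\mathrm{Var}(S_t)=\frac{\sigma_s^2e^{-2\lambda_st}(e^{2\lambda_st}-1)}{2\lambda_s},$$ $$\mathrm{Var}(V_t)=\frac{e^{-2(\gamma_v+2\lambda_s)t}}{2\gamma_v\lambda_s^2(\gamma_v-2\lambda_s)^2(\gamma_v-\lambda_s)(2\gamma_v-\lambda_s)(\gamma_v+\lambda_s)(\gamma_v+2\lambda_s)}\,\bigl[-a+b-c-d+e+f\bigr],$$ $$\begin{aligned}\mathrm{Cov}(S_t,V_t)=\frac{\sigma_se^{-(\gamma_v+3\lambda_s)t}}{\gamma_v\lambda_s(\gamma_v-2\lambda_s)(\gamma_v+\lambda_s)}\Bigl[&\beta_v\sigma_s(\gamma_v^2-\gamma_v\lambda_s-2\lambda_s^2)(S_0-\mu_s)e^{(\gamma_v+2\lambda_s)t}\\&+\lambda_se^{2\lambda_st}\left(-2\beta_v\mu_s\sigma_s(\gamma_v+\lambda_s)-\gamma_v\rho_{sv}\sigma_v(\gamma_v-2\lambda_s)+2\beta_vS_0\sigma_s(\gamma_v+\lambda_s)\right)\\&-\beta_v\gamma_v\sigma_s(\gamma_v+\lambda_s)(S_0-\mu_s)e^{\gamma_vt}+\gamma_v\lambda_s\rho_{sv}\sigma_v(\gamma_v-2\lambda_s)e^{(\gamma_v+3\lambda_s)t}\Bigr],\end{aligned}$$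 where $$\begin{aligned}a={}&\lambda_s^2(\gamma_v^2+3\gamma_v\lambda_s+2\lambda_s^2)e^{4\lambda_st}\Bigl[2\beta_v^2\sigma_s^2(2\gamma_v-\lambda_s)(2\gamma_v\mu_s^2-\sigma_s^2)+8\beta_v\gamma_v\mu_s\rho_{sv}\sigma_s\sigma_v(\gamma_v^2-3\gamma_v\lambda_s+2\lambda_s^2)\\&+\sigma_v^2(\gamma_v-2\lambda_s)^2(2\gamma_v^2-3\gamma_v\lambda_s+\lambda_s^2)+4\beta_v^2\gamma_vS_0^2\sigma_s^2(2\gamma_v-\lambda_s)\\&-8\beta_v\gamma_vS_0\sigma_s\left(\beta_v\mu_s\sigma_s(2\gamma_v-\lambda_s)+\rho_{sv}\sigma_v(\gamma_v^2-3\gamma_v\lambda_s+2\lambda_s^2)\right)\Bigr],\\ b={}&2\beta_v^2\sigma_s^2(2\gamma_v^3+5\gamma_v^2\lambda_s+\gamma_v\lambda_s^2-2\lambda_s^3)(\gamma_v-2\lambda_s)^2e^{2(\gamma_v+\lambda_s)t}(2\lambda_s\mu_s^2+2\lambda_sS_0^2-4\lambda_s\mu_sS_0-\sigma_s^2),\\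 c={}&\beta_v^2\gamma_v\sigma_s^2(2\gamma_v^4+3\gamma_v^3\lambda_s-4\gamma_v^2\lambda_s^2-3\gamma_v\lambda_s^3+2\lambda_s^4)e^{2\gamma_vt}(4\lambda_s\mu_s^2+4\lambda_sS_0^2-8\lambda_s\mu_sS_0-\sigma_s^2),\\ d={}&8\beta_v\lambda_s^2\sigma_s(2\gamma_v^2-3\gamma_v\lambda_s+\lambda_s^2)e^{(\gamma_v+2\lambda_s)t}\Bigl[2\beta_v\sigma_s\left(-\gamma_v^2\mu_s^2+\gamma_v(\sigma_s^2-3\lambda_s\mu_s^2)+\lambda_s(\sigma_s^2-2\lambda_s\mu_s^2)\right)\\&-\gamma_v\mu_s\rho_{sv}\sigma_v(\gamma_v^2-4\lambda_s^2)-2\beta_vS_0^2\sigma_s(\gamma_v^2+3\gamma_v\lambda_s+2\lambda_s^2)\\&+S_0(\gamma_v+2\lambda_s)\left(4\beta_v\mu_s\sigma_s(\gamma_v+\lambda_s)+\gamma_v\rho_{sv}\sigma_v(\gamma_v-2\lambda_s)\right)\Bigr],\\ e={}&8\beta_v\gamma_v\lambda_s^2\rho_{sv}\sigma_s\sigma_v(\gamma_v^2+\gamma_v\lambda_s-2\lambda_s^2)(\gamma_v-2\lambda_s)^2(S_0-\mu_s)e^{(2\gamma_v+3\lambda_s)t},\\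 f={}&(2\gamma_v^3-\gamma_v^2\lambda_s-2\gamma_v\lambda_s^2+\lambda_s^3)(\gamma_v-2\lambda_s)^2e^{2(\gamma_v+2\lambda_s)t}\left(\beta_v^2\sigma_s^4+\lambda_s^2\sigma_v^2(\gamma_v+2\lambda_s)\right).\end{aligned}$$ -/

import Mathlib

open MeasureTheory ProbabilityTheory
open scoped NNReal

/-- `(Ws, Wv)` is a pair of standard Brownian motions with instantaneous correlation `ρ`, written
`corr(dWs, dWv) = ρ`: both are Brownian motions, they are jointly Gaussian, and
`Cov(Ws u, Wv t) = ρ min(u, t)`. -/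
structure IsCorrelatedBrownian {Ω : Type*} [MeasurableSpace Ω] (Ws Wv : ℝ≥0 → Ω → ℝ) (ρ : ℝ)
    (P : Measure Ω) : Prop where
  brownian_s : IsBrownianReal Ws P
  brownian_v : IsBrownianReal Wv P
  gaussian : IsGaussianProcess (Sum.elim Ws Wv) P
  cov_eq : ∀ u t : ℝ≥0, cov[Ws u, Wv t; P] = ρ * (min u t : ℝ≥0)

/-- `(S, V)` solves the sentiment and volatility equations
`dS = lam (μs - S) dt + σs dWs`, `dV = (μv + β (S - μs)² - γ V) dt + σv dWv`
with deterministic initial values `S₀`, `V₀`, where `corr(dWs, dWv) = ρ`. The diffusion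
coefficients are constants, so the integral form of the equations contains
`∫₀ᵗ σs dWs = σs Ws t` and `∫₀ᵗ σv dWv = σv Wv t` (a Brownian motion starts at `0`). -/
structure IsSSVSolution {Ω : Type*} [MeasurableSpace Ω] (P : Measure Ω)
    (lam γ μs σs μv β σv ρ S₀ V₀ : ℝ) (Ws Wv S V : ℝ≥0 → Ω → ℝ) : Prop where
  noise : IsCorrelatedBrownian Ws Wv ρ P
  aemeasurable_S : ∀ t, AEMeasurable (S t) P
  aemeasurable_V : ∀ t, AEMeasurable (V t) P
  continuous_S : ∀ᵐ ω ∂P, Continuous fun t => S t ω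
  continuous_V : ∀ᵐ ω ∂P, Continuous fun t => V t ω
  eq_S : ∀ᵐ ω ∂P, ∀ t : ℝ≥0,
    S t ω = S₀ + (∫ u in (0 : ℝ)..t, lam * (μs - S u.toNNReal ω)) + σs * Ws t ω
  eq_V : ∀ᵐ ω ∂P, ∀ t : ℝ≥0,
    V t ω = V₀ + (∫ u in (0 : ℝ)..t,
      (μv + β * (S u.toNNReal ω - μs) ^ 2 - γ * V u.toNNReal ω)) + σv * Wv t ω

noncomputable section

/-! The six terms `a`, …, `f` of the closed form of `Var(V_t)`. -/

def ssvA (lam γ μs σs β σv ρ S₀ t : ℝ) : ℝ :=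
  lam ^ 2 * (γ ^ 2 + 3 * γ * lam + 2 * lam ^ 2) * Real.exp (4 * lam * t) *
    (2 * β ^ 2 * σs ^ 2 * (2 * γ - lam) * (2 * γ * μs ^ 2 - σs ^ 2)
      + 8 * β * γ * μs * ρ * σs * σv * (γ ^ 2 - 3 * γ * lam + 2 * lam ^ 2)
      + σv ^ 2 * (γ - 2 * lam) ^ 2 * (2 * γ ^ 2 - 3 * γ * lam + lam ^ 2)
      + 4 * β ^ 2 * γ * S₀ ^ 2 * σs ^ 2 * (2 * γ - lam)
      - 8 * β * γ * S₀ * σs * (β * μs * σs * (2 * γ - lam)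
        + ρ * σv * (γ ^ 2 - 3 * γ * lam + 2 * lam ^ 2)))

def ssvB (lam γ μs σs β S₀ t : ℝ) : ℝ :=
  2 * β ^ 2 * σs ^ 2 * (2 * γ ^ 3 + 5 * γ ^ 2 * lam + γ * lam ^ 2 - 2 * lam ^ 3) *
    (γ - 2 * lam) ^ 2 * Real.exp (2 * (γ + lam) * t) *
    (2 * lam * μs ^ 2 + 2 * lam * S₀ ^ 2 - 4 * lam * μs * S₀ - σs ^ 2)

def ssvC (lam γ μs σs β S₀ t : ℝ) : ℝ :=
  β ^ 2 * γ * σs ^ 2 *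
    (2 * γ ^ 4 + 3 * γ ^ 3 * lam - 4 * γ ^ 2 * lam ^ 2 - 3 * γ * lam ^ 3 + 2 * lam ^ 4) *
    Real.exp (2 * γ * t) *
    (4 * lam * μs ^ 2 + 4 * lam * S₀ ^ 2 - 8 * lam * μs * S₀ - σs ^ 2)

def ssvD (lam γ μs σs β σv ρ S₀ t : ℝ) : ℝ :=
  8 * β * lam ^ 2 * σs * (2 * γ ^ 2 - 3 * γ * lam + lam ^ 2) * Real.exp ((γ + 2 * lam) * t) *
    (2 * β * σs * (-γ ^ 2 * μs ^ 2 + γ * (σs ^ 2 - 3 * lam * μs ^ 2)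
        + lam * (σs ^ 2 - 2 * lam * μs ^ 2))
      - γ * μs * ρ * σv * (γ ^ 2 - 4 * lam ^ 2)
      - 2 * β * S₀ ^ 2 * σs * (γ ^ 2 + 3 * γ * lam + 2 * lam ^ 2)
      + S₀ * (γ + 2 * lam) * (4 * β * μs * σs * (γ + lam) + γ * ρ * σv * (γ - 2 * lam)))

def ssvE (lam γ μs σs β σv ρ S₀ t : ℝ) : ℝ :=
  8 * β * γ * lam ^ 2 * ρ * σs * σv * (γ ^ 2 + γ * lam - 2 * lam ^ 2) * (γ - 2 * lam) ^ 2 *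
    (S₀ - μs) * Real.exp ((2 * γ + 3 * lam) * t)

def ssvF (lam γ σs β σv t : ℝ) : ℝ :=
  (2 * γ ^ 3 - γ ^ 2 * lam - 2 * γ * lam ^ 2 + lam ^ 3) * (γ - 2 * lam) ^ 2 *
    Real.exp (2 * (γ + 2 * lam) * t) *
    (β ^ 2 * σs ^ 4 + lam ^ 2 * σv ^ 2 * (γ + 2 * lam))

end

/-! Both equations have additive noise, so variation of constants solves them path by path, and
integration by parts removes the stochastic integrals. With `Y` and `N` the Ornstein-Uhlenbeck
processes of rates `lam` and `γ` driven by `Ws` and `Wv` from `0`, and `m u = exp (-lam u) (S₀ -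
μs)`, the result is `S t = μs + m t + σs Y t`, while `V t` is a deterministic term plus `σv N t`
plus `β exp (-γ t) ∫₀ᵗ exp (γ u) (m u + σs Y u)² du`. This is `IsSSVSolution.exists_representation`.

By Fubini, every mean and covariance becomes a time integral of moments of quadratic polynomials in
centered, jointly Gaussian variables. Two facts suffice: `Cov(A², B) = 0` and `Cov(A², B²) = 2
Cov(A, B)²`. Polarization derives them from the third and fourth moments of a single Gaussian.

Joint Gaussianity of `Y` and `N` is obtained in `L²`. Centered Gaussians form a closed set there, so
every element of the closed span of `Ws` and `Wv` is Gaussian, and time integrals stay in that span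
(`IsRegularProcess.inClosedSpan_integral`). The covariances of `Y` and `N` come from `min u t`
(`covariance_ornsteinUhlenbeck`).

The variance of the quadratic functional is a double integral of a symmetric kernel that factors
into a function of the smaller time and a function of the larger one. All remaining integrals are of
exponentials, and the closed forms are identities of rational functions in `exp (γ t)` and `exp (lam
t)`. -/

section GaussianMoments

/-! ### Moments of centered Gaussian variables up to order four. -/

theorem hasDerivAt_quadratic_exp (v x : ℝ) :
    HasDerivAt (fun s => Real.exp (v * s ^ 2 / 2)) (v * x * Real.exp (v * x ^ 2 / 2)) x := by
  have h : HasDerivAt (fun s : ℝ => v * s ^ 2 / 2) (v * x) x := by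
    refine (((hasDerivAt_pow 2 x).const_mul v).div_const 2).congr_deriv ?_
    norm_num
    ring
  exact h.exp.congr_deriv (by ring)

/-- The function is the moment generating function of the centered Gaussian law of variance `v`, so
these derivatives are its third and fourth moments. Each derivative is a polynomial times the same
exponential. -/
theorem iteratedDeriv_quadratic_exp (v : ℝ) :
    iteratedDeriv 3 (fun s => Real.exp (v * s ^ 2 / 2)) 0 = 0 ∧
      iteratedDeriv 4 (fun s => Real.exp (v * s ^ 2 / 2)) 0 = 3 * v ^ 2 := by
  have h1 : deriv (fun s => Real.exp (v * s ^ 2 / 2)) =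
      fun s => v * s * Real.exp (v * s ^ 2 / 2) :=
    funext fun x => (hasDerivAt_quadratic_exp v x).deriv
  have h2 : deriv (fun s => v * s * Real.exp (v * s ^ 2 / 2)) =
      fun s => (v + v ^ 2 * s ^ 2) * Real.exp (v * s ^ 2 / 2) := funext fun x => by
    refine HasDerivAt.deriv ?_
    refine (((hasDerivAt_id x).const_mul v).mul (hasDerivAt_quadratic_exp v x)).congr_deriv ?_
    simp only [id]
    ring
  have h3 : deriv (fun s => (v + v ^ 2 * s ^ 2) * Real.exp (v * s ^ 2 / 2)) =
      fun s => (3 * v ^ 2 * s + v ^ 3 * s ^ 3) * Real.exp (v * s ^ 2 / 2) := funext fun x => by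
    refine HasDerivAt.deriv ?_
    refine ((((hasDerivAt_pow 2 x).const_mul (v ^ 2)).const_add v).mul
      (hasDerivAt_quadratic_exp v x)).congr_deriv ?_
    norm_num
    ring
  have h4 : deriv (fun s => (3 * v ^ 2 * s + v ^ 3 * s ^ 3) * Real.exp (v * s ^ 2 / 2)) 0 =
      3 * v ^ 2 := by
    refine HasDerivAt.deriv ?_
    refine ((((hasDerivAt_id (0 : ℝ)).const_mul (3 * v ^ 2)).add
      ((hasDerivAt_pow 3 (0 : ℝ)).const_mul (v ^ 3))).mul
      (hasDerivAt_quadratic_exp v 0)).congr_deriv ?_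
    norm_num
  constructor
  · rw [iteratedDeriv_succ, iteratedDeriv_succ, iteratedDeriv_one, h1, h2, h3]
    simp
  · rw [iteratedDeriv_succ, iteratedDeriv_succ, iteratedDeriv_succ, iteratedDeriv_one, h1, h2, h3,
      h4]

theorem integral_pow_gaussianReal (v : ℝ≥0) :
    ∫ x, x ^ 3 ∂gaussianReal 0 v = 0 ∧ ∫ x, x ^ 4 ∂gaussianReal 0 v = 3 * (v : ℝ) ^ 2 := by
  have hint : (0 : ℝ) ∈ interior (integrableExpSet id (gaussianReal 0 v)) := by
    simp [integrableExpSet_id_gaussianReal]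
  have hm : mgf id (gaussianReal 0 v) = fun s => Real.exp ((v : ℝ) * s ^ 2 / 2) := by
    rw [mgf_id_gaussianReal]
    simp
  have h3 := iteratedDeriv_mgf_zero hint 3
  have h4 := iteratedDeriv_mgf_zero hint 4
  rw [hm] at h3 h4
  rw [(iteratedDeriv_quadratic_exp v).1] at h3
  rw [(iteratedDeriv_quadratic_exp v).2] at h4
  exact ⟨by simpa using h3.symm, by simpa using h4.symm⟩

variable {Ω : Type*} [MeasurableSpace Ω] {P : Measure Ω}

/-- A real random variable that is Gaussian (possibly degenerate) with mean zero. -/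
structure IsCenteredGaussian (A : Ω → ℝ) (P : Measure Ω) : Prop where
  gaussian : HasGaussianLaw A P
  mean : ∫ ω, A ω ∂P = 0

namespace IsCenteredGaussian

variable {A B : Ω → ℝ}

theorem memLp (h : IsCenteredGaussian A P) {p : ENNReal} (hp : p ≠ ⊤) : MemLp A p P :=
  h.gaussian.memLp hp

theorem integrable_pow (h : IsCenteredGaussian A P) (n : ℕ) :
    Integrable (fun ω => A ω ^ n) P := by
  have := h.gaussian.isProbabilityMeasure
  rcases Nat.eq_zero_or_pos n with rfl | hn
  · simp
  · have := (h.memLp (p := (n : ENNReal)) (by simp)).integrable_norm_pow hn.ne'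
    refine (integrable_norm_iff ?_).1 (by simpa using this)
    exact (h.gaussian.aemeasurable.pow_const n).aestronglyMeasurable

theorem memLp_sq (hA : IsCenteredGaussian A P) : MemLp (fun ω => A ω ^ 2) 2 P := by
  refine (memLp_two_iff_integrable_sq
    (hA.gaussian.aemeasurable.pow_const 2).aestronglyMeasurable).2 ?_
  simpa only [← pow_mul] using hA.integrable_pow 4

theorem integral_pow_three (h : IsCenteredGaussian A P) : ∫ ω, A ω ^ 3 ∂P = 0 := by
  have e := h.gaussian.map_eq_gaussianReal
  rw [h.mean] at e
  rw [← (integral_pow_gaussianReal (Var[A; P].toNNReal)).1, ← e,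
    integral_map h.gaussian.aemeasurable (by fun_prop)]

theorem integral_pow_four (h : IsCenteredGaussian A P) :
    ∫ ω, A ω ^ 4 ∂P = 3 * (∫ ω, A ω ^ 2 ∂P) ^ 2 := by
  have e := h.gaussian.map_eq_gaussianReal
  rw [h.mean] at e
  have hv : Var[A; P] = ∫ ω, A ω ^ 2 ∂P := by
    rw [variance_of_integral_eq_zero h.gaussian.aemeasurable h.mean]
  have := (integral_pow_gaussianReal (Var[A; P].toNNReal)).2
  rw [← e, integral_map h.gaussian.aemeasurable (by fun_prop),
    Real.coe_toNNReal _ (variance_nonneg _ _), hv] at this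
  exact this

/-- Polarization writes the mixed moment as a combination of cubes of `A + B`, `A - B` and `B`, so
only one-dimensional Gaussian laws are needed, never a joint density. -/
theorem integral_sq_mul (hB : IsCenteredGaussian B P)
    (hadd : IsCenteredGaussian (fun ω => A ω + B ω) P)
    (hsub : IsCenteredGaussian (fun ω => A ω - B ω) P) :
    ∫ ω, A ω ^ 2 * B ω ∂P = 0 := by
  have e : (fun ω => A ω ^ 2 * B ω) = fun ω =>
      (1 / 6) * (A ω + B ω) ^ 3 - (1 / 6) * (A ω - B ω) ^ 3 - (1 / 3) * B ω ^ 3 := by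
    ext ω; ring
  have i1 := (hadd.integrable_pow 3).const_mul (1 / 6)
  have i2 := (hsub.integrable_pow 3).const_mul (1 / 6)
  have i3 := (hB.integrable_pow 3).const_mul (1 / 3)
  have i12 : Integrable (fun ω => 1 / 6 * (A ω + B ω) ^ 3 - 1 / 6 * (A ω - B ω) ^ 3) P := i1.sub i2
  rw [e, integral_sub i12 i3, integral_sub i1 i2, integral_const_mul, integral_const_mul,
    integral_const_mul, hadd.integral_pow_three, hsub.integral_pow_three, hB.integral_pow_three]
  simp

theorem integrable_mul (hA : IsCenteredGaussian A P) (hB : IsCenteredGaussian B P) :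
    Integrable (fun ω => A ω * B ω) P :=
  (hA.memLp (p := 2) (by simp)).integrable_mul (hB.memLp (p := 2) (by simp))

/-- Isserlis' formula, again by polarization: fourth powers of `A + B`, `A - B`, `A` and `B` reduce
it to the fourth moment of one Gaussian. -/
theorem integral_sq_mul_sq (hA : IsCenteredGaussian A P) (hB : IsCenteredGaussian B P)
    (hadd : IsCenteredGaussian (fun ω => A ω + B ω) P)
    (hsub : IsCenteredGaussian (fun ω => A ω - B ω) P) :
    ∫ ω, A ω ^ 2 * B ω ^ 2 ∂P =
      (∫ ω, A ω ^ 2 ∂P) * (∫ ω, B ω ^ 2 ∂P) + 2 * (∫ ω, A ω * B ω ∂P) ^ 2 := by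
  have e : (fun ω => A ω ^ 2 * B ω ^ 2) = fun ω =>
      (1 / 12) * (A ω + B ω) ^ 4 + (1 / 12) * (A ω - B ω) ^ 4 -
        ((1 / 6) * A ω ^ 4 + (1 / 6) * B ω ^ 4) := by
    ext ω; ring
  have i1 := (hadd.integrable_pow 4).const_mul (1 / 12)
  have i2 := (hsub.integrable_pow 4).const_mul (1 / 12)
  have i3 := (hA.integrable_pow 4).const_mul (1 / 6)
  have i4 := (hB.integrable_pow 4).const_mul (1 / 6)
  have jA := hA.integrable_pow 2
  have jB := hB.integrable_pow 2
  have jAB := (hA.integrable_mul hB).const_mul 2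
  have eadd : ∫ ω, (A ω + B ω) ^ 2 ∂P =
      (∫ ω, A ω ^ 2 ∂P) + (∫ ω, B ω ^ 2 ∂P) + 2 * ∫ ω, A ω * B ω ∂P := by
    rw [← integral_const_mul, ← integral_add jA jB, ← integral_add (jA.fun_add jB) jAB]
    congr 1; ext ω; ring
  have esub : ∫ ω, (A ω - B ω) ^ 2 ∂P =
      (∫ ω, A ω ^ 2 ∂P) + (∫ ω, B ω ^ 2 ∂P) - 2 * ∫ ω, A ω * B ω ∂P := by
    rw [← integral_const_mul, ← integral_add jA jB, ← integral_sub (jA.fun_add jB) jAB]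
    congr 1; ext ω; ring
  rw [e, integral_sub (i1.fun_add i2) (i3.fun_add i4), integral_add i1 i2, integral_add i3 i4,
    integral_const_mul, integral_const_mul, integral_const_mul, integral_const_mul,
    hadd.integral_pow_four, hsub.integral_pow_four, hA.integral_pow_four, hB.integral_pow_four,
    eadd, esub]
  ring

end IsCenteredGaussian

end GaussianMoments

/-! ### Gaussianity of the closed linear span in `L²`. -/

section GaussianSpan

variable {Ω ι : Type*} [MeasurableSpace Ω] {P : Measure Ω}

/-- From `|exp (ix) - 1| ≤ |x|`. It makes the characteristic function at each `s` continuous on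
`L²`. -/
theorem norm_integral_cexp_sub_le [IsProbabilityMeasure P] {A B : Ω → ℝ} (hA : MemLp A 2 P) (hB : MemLp B 2 P) (s : ℝ) :
    ‖(∫ ω, Complex.exp (s * A ω * Complex.I) ∂P) - ∫ ω, Complex.exp (s * B ω * Complex.I) ∂P‖ ≤
      |s| * ∫ ω, |A ω - B ω| ∂P := by
  have hint : ∀ {C : Ω → ℝ}, MemLp C 2 P →
      Integrable (fun ω => Complex.exp (s * C ω * Complex.I)) P := by
    intro C hC
    refine Integrable.of_bound (C := 1) ?_ (ae_of_all _ fun ω => ?_)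
    · have := hC.aestronglyMeasurable.aemeasurable
      exact AEMeasurable.aestronglyMeasurable (by fun_prop)
    · rw [← Complex.ofReal_mul, Complex.norm_exp_ofReal_mul_I]
  rw [← integral_sub (hint hA) (hint hB), ← integral_const_mul]
  refine norm_integral_le_of_norm_le ?_ (ae_of_all _ fun ω => ?_)
  · exact (((hA.sub hB).integrable (by norm_num)).abs).const_mul _
  · have e : Complex.exp (s * A ω * Complex.I) - Complex.exp (s * B ω * Complex.I) =
        Complex.exp ((s * B ω : ℝ) * Complex.I) *
          (Complex.exp (Complex.I * (s * (A ω - B ω) : ℝ)) - 1) := by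
      rw [mul_sub, ← Complex.exp_add, mul_one]
      push_cast
      ring_nf
    rw [e, norm_mul, Complex.norm_exp_ofReal_mul_I, one_mul, ← abs_mul]
    exact Real.norm_exp_I_mul_ofReal_sub_one_le

/-- Square integrable centered Gaussian variables form a closed subset of `L²`. -/
theorem isClosed_isCenteredGaussian [IsProbabilityMeasure P] :
    IsClosed {f : Lp ℝ 2 P | IsCenteredGaussian f P} := by
  have hchar : ∀ s : ℝ, Continuous fun f : Lp ℝ 2 P =>
      ∫ ω, Complex.exp (s * f ω * Complex.I) ∂P := by
    intro s
    have : LipschitzWith (‖s‖₊) fun f : Lp ℝ 2 P => ∫ ω, Complex.exp (s * f ω * Complex.I) ∂P := by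
      refine LipschitzWith.of_dist_le_mul fun f g => ?_
      rw [dist_eq_norm, dist_eq_norm]
      refine (norm_integral_cexp_sub_le (Lp.memLp f) (Lp.memLp g) s).trans ?_
      refine mul_le_mul_of_nonneg_left ?_ (abs_nonneg _)
      have h1 : ∫ ω, |f ω - g ω| ∂P = ∫ ω, ‖(f - g : Lp ℝ 2 P) ω‖ ∂P := by
        refine integral_congr_ae ?_
        filter_upwards [Lp.coeFn_sub f g] with ω h
        rw [h, Real.norm_eq_abs, Pi.sub_apply]
      rw [h1, Lp.norm_def]
      have hm := Lp.memLp (f - g)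
      rw [integral_norm_eq_lintegral_enorm hm.aestronglyMeasurable, ← eLpNorm_one_eq_lintegral_enorm]
      exact ENNReal.toReal_mono hm.eLpNorm_ne_top
        (eLpNorm_le_eLpNorm_of_exponent_le (by norm_num) hm.aestronglyMeasurable)
    exact this.continuous
  -- The variance of a centered `f` is `‖f‖²`, so being centered Gaussian is one equation between
  -- continuous functions of `f` for each `s`. Degenerate laws are included, so the limit may have
  -- variance zero.
  have hset : {f : Lp ℝ 2 P | IsCenteredGaussian f P} = ⋂ s : ℝ, {f : Lp ℝ 2 P |
      ∫ ω, Complex.exp (s * f ω * Complex.I) ∂P = Complex.exp (-((‖f‖ ^ 2 * s ^ 2 / 2 : ℝ) : ℂ))} := by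
    ext f
    have hf := Lp.memLp f
    have hfm := hf.aestronglyMeasurable.aemeasurable
    have hcf : ∀ s : ℝ, charFun (P.map f) s = ∫ ω, Complex.exp (s * f ω * Complex.I) ∂P := by
      intro s
      rw [charFun_apply_real, integral_map hfm (by fun_prop)]
    have hnorm : ‖f‖ ^ 2 = ∫ ω, f ω ^ 2 ∂P := by
      rw [← real_inner_self_eq_norm_sq, L2.inner_def]
      simp [sq]
    simp only [Set.mem_ofPred_eq, Set.mem_iInter]
    constructor
    · intro h s
      have e := h.gaussian.map_eq_gaussianReal
      rw [h.mean] at e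
      rw [← hcf, e, charFun_gaussianReal, Real.coe_toNNReal _ (variance_nonneg _ _),
        variance_of_integral_eq_zero hfm h.mean, ← hnorm]
      push_cast
      ring_nf
    · intro h
      have hmap : P.map f = gaussianReal 0 (‖f‖₊ ^ 2) := by
        have := Measure.isProbabilityMeasure_map (μ := P) hfm
        refine Measure.ext_of_charFun (funext fun s => ?_)
        rw [hcf, h s, charFun_gaussianReal]
        push_cast
        simp
      refine ⟨⟨by rw [hmap]; infer_instance⟩, ?_⟩
      have := integral_map (μ := P) hfm (f := fun x : ℝ => x) (by fun_prop)
      rw [← this, hmap, integral_id_gaussianReal]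
  rw [hset]
  refine isClosed_iInter fun s => isClosed_eq (hchar s) ?_
  fun_prop

/-- The closed subspace of `L²` generated by a family of random variables. Variables that are not
square integrable are ignored. -/
noncomputable def closedSpan (X : ι → Ω → ℝ) (P : Measure Ω) : Submodule ℝ (Lp ℝ 2 P) :=
  (Submodule.span ℝ {f : Lp ℝ 2 P | ∃ i, f =ᵐ[P] X i}).topologicalClosure

/-- `A` represents an element of the closed subspace of `L²` generated by the family `X`. -/
def InClosedSpan (X : ι → Ω → ℝ) (P : Measure Ω) (A : Ω → ℝ) : Prop :=
  ∃ f ∈ closedSpan X P, f =ᵐ[P] A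

namespace InClosedSpan

variable {X : ι → Ω → ℝ} {A B : Ω → ℝ}

theorem congr (hA : InClosedSpan X P A) (h : A =ᵐ[P] B) : InClosedSpan X P B := by
  obtain ⟨f, hf, hfA⟩ := hA
  exact ⟨f, hf, hfA.trans h⟩

theorem memLp (hA : InClosedSpan X P A) : MemLp A 2 P := by
  obtain ⟨f, -, hfA⟩ := hA
  exact (memLp_congr_ae hfA).1 (Lp.memLp f)

theorem of_mem {i : ι} (h : MemLp (X i) 2 P) : InClosedSpan X P (X i) :=
  ⟨h.toLp (X i), Submodule.le_topologicalClosure _ (Submodule.subset_span ⟨i, h.coeFn_toLp⟩),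
    h.coeFn_toLp⟩

theorem add (hA : InClosedSpan X P A) (hB : InClosedSpan X P B) :
    InClosedSpan X P (fun ω => A ω + B ω) := by
  obtain ⟨f, hf, hfA⟩ := hA
  obtain ⟨g, hg, hgB⟩ := hB
  refine ⟨f + g, add_mem hf hg, (Lp.coeFn_add f g).trans ?_⟩
  filter_upwards [hfA, hgB] with ω h1 h2
  simp [h1, h2]

theorem const_mul (hA : InClosedSpan X P A) (c : ℝ) : InClosedSpan X P (fun ω => c * A ω) := by
  obtain ⟨f, hf, hfA⟩ := hA
  refine ⟨c • f, Submodule.smul_mem _ c hf, (Lp.coeFn_smul c f).trans ?_⟩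
  filter_upwards [hfA] with ω h1
  simp [h1]

theorem sub (hA : InClosedSpan X P A) (hB : InClosedSpan X P B) :
    InClosedSpan X P (fun ω => A ω - B ω) := by
  refine (hA.add (hB.const_mul (-1))).congr (ae_of_all _ fun ω => ?_)
  simp only
  ring

/-- Membership in a closed span can be tested against the variables orthogonal to the family. -/
theorem of_forall_orthogonal (hA : MemLp A 2 P)
    (h : ∀ Z : Ω → ℝ, MemLp Z 2 P → (∀ B, InClosedSpan X P B → ∫ ω, Z ω * B ω ∂P = 0) →
      ∫ ω, Z ω * A ω ∂P = 0) : InClosedSpan X P A := by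
  refine ⟨hA.toLp A, ?_, hA.coeFn_toLp⟩
  have hcl : IsClosed (closedSpan X P : Set (Lp ℝ 2 P)) :=
    Submodule.isClosed_topologicalClosure _
  have hc : CompleteSpace (closedSpan X P) := hcl.completeSpace_coe
  have hinner : ∀ (z : Lp ℝ 2 P) (B : Ω → ℝ) (b : Lp ℝ 2 P), b =ᵐ[P] B →
      inner ℝ b z = ∫ ω, z ω * B ω ∂P := by
    intro z B b hb
    rw [L2.inner_def]
    refine integral_congr_ae ?_
    filter_upwards [hb] with ω hω
    simp [hω]
  -- A closed subspace of a Hilbert space is its own double orthogonal complement.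
  rw [← Submodule.orthogonal_orthogonal (closedSpan X P), Submodule.mem_orthogonal]
  intro z hz
  rw [real_inner_comm, hinner z A _ hA.coeFn_toLp]
  refine h z (Lp.memLp z) fun B ⟨b, hb, hbB⟩ => ?_
  rw [← hinner z B b hbB]
  exact (Submodule.mem_orthogonal _ _).1 hz b hb

/-- Since the centered Gaussians are closed in `L²`, only finite linear combinations of the family
need checking, and there Gaussianity is the definition of a Gaussian process. -/
theorem isCenteredGaussian [IsProbabilityMeasure P] (hX : IsGaussianProcess X P) (hmean : ∀ i, ∫ ω, X i ω ∂P = 0)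
    (hA : InClosedSpan X P A) : IsCenteredGaussian A P := by
  obtain ⟨f, hf, hfA⟩ := hA
  suffices h : IsCenteredGaussian f P from
    ⟨h.gaussian.congr hfA, by rw [← integral_congr_ae hfA]; exact h.mean⟩
  refine closure_minimal ?_ isClosed_isCenteredGaussian hf
  intro g hg
  classical
  have hspan : ({f : Lp ℝ 2 P | ∃ i, f =ᵐ[P] X i}) =
      Set.range fun i => ((hX.hasGaussianLaw_eval i).memLp_two.toLp (X i)) := by
    ext f
    constructor
    · rintro ⟨i, hi⟩
      exact ⟨i, Lp.ext ((MemLp.coeFn_toLp _).trans hi.symm)⟩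
    · rintro ⟨i, rfl⟩
      exact ⟨i, MemLp.coeFn_toLp _⟩
  rw [hspan] at hg
  obtain ⟨c, rfl⟩ := (Finsupp.mem_span_range_iff_exists_finsupp).1 hg
  have hcoe : ((c.sum fun i a => a • ((hX.hasGaussianLaw_eval i).memLp_two.toLp (X i)) :
      Lp ℝ 2 P) : Ω → ℝ) =ᵐ[P] fun ω => ∑ i ∈ c.support, c i * X i ω := by
    refine (Lp.coeFn_finsetSum _ _).trans ?_
    have : ∀ᵐ ω ∂P, ∀ i : c.support,
        ((c i • ((hX.hasGaussianLaw_eval i).memLp_two.toLp (X i)) : Lp ℝ 2 P) : Ω → ℝ) ω =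
          c i * X i ω := by
      refine ae_all_iff.2 fun i => ?_
      filter_upwards [Lp.coeFn_smul (c i) ((hX.hasGaussianLaw_eval i).memLp_two.toLp (X i)),
        (hX.hasGaussianLaw_eval i).memLp_two.coeFn_toLp] with ω h1 h2
      rw [h1, Pi.smul_apply, h2, smul_eq_mul]
    filter_upwards [this] with ω h
    rw [Finset.sum_apply]
    exact Finset.sum_congr rfl fun i hi => h ⟨i, hi⟩
  have hg := (hX.smul c).hasGaussianLaw_fun_sum (I := c.support)
  simp only [smul_eq_mul] at hg
  refine ⟨?_, ?_⟩
  · exact hg.congr hcoe.symm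
  · rw [integral_congr_ae hcoe, integral_finsetSum]
    · simp [integral_const_mul, hmean]
    · exact fun i _ => (hX.hasGaussianLaw_eval i).integrable.const_mul _

end InClosedSpan

end GaussianSpan

/-! ### Time integrals of processes bounded in `L²`, and Fubini. -/

section RegularProcess

variable {Ω : Type*} [MeasurableSpace Ω] {P : Measure Ω}

/-- A process with measurable marginals and continuous paths that is bounded in `L²` on each
interval `[0, t]`. -/
structure IsRegularProcess (g : ℝ → Ω → ℝ) (P : Measure Ω) : Prop where
  measurable : ∀ u, Measurable (g u)
  continuous : ∀ ω, Continuous fun u => g u ω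
  bounded : ∀ t, ∃ C, ∀ u ∈ Set.Icc 0 t, MemLp (g u) 2 P ∧ ∫ ω, g u ω ^ 2 ∂P ≤ C

theorem sq_intervalIntegral_le {f : ℝ → ℝ} (hf : Continuous f) {t : ℝ} (ht : 0 ≤ t) :
    (∫ u in (0 : ℝ)..t, f u) ^ 2 ≤ t * ∫ u in (0 : ℝ)..t, f u ^ 2 := by
  rcases ht.eq_or_lt with rfl | ht
  · simp
  set I := ∫ u in (0 : ℝ)..t, f u with hI
  -- The Cauchy-Schwarz gap is the integrated squared deviation of `f` from its average `I / t`,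
  -- scaled by `t` to avoid division.
  have h0 : 0 ≤ ∫ u in (0 : ℝ)..t, (t * f u - I) ^ 2 :=
    intervalIntegral.integral_nonneg ht.le fun u _ => sq_nonneg _
  have e : ∫ u in (0 : ℝ)..t, (t * f u - I) ^ 2 =
      t * (t * (∫ u in (0 : ℝ)..t, f u ^ 2) - I ^ 2) := by
    have : ∀ u, (t * f u - I) ^ 2 = t ^ 2 * f u ^ 2 - 2 * t * I * f u + I ^ 2 := fun u => by ring
    simp only [this]
    have i1 : IntervalIntegrable (fun u => t ^ 2 * f u ^ 2) volume 0 t :=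
      Continuous.intervalIntegrable (by fun_prop) _ _
    have i2 : IntervalIntegrable (fun u => 2 * t * I * f u) volume 0 t :=
      Continuous.intervalIntegrable (by fun_prop) _ _
    rw [intervalIntegral.integral_add (i1.sub i2) (by simp), intervalIntegral.integral_sub i1 i2,
      intervalIntegral.integral_const_mul, intervalIntegral.integral_const_mul, ← hI]
    simp
    ring
  rw [e] at h0
  nlinarith [(mul_nonneg_iff_of_pos_left ht).1 h0]

namespace IsRegularProcess

variable {g f : ℝ → Ω → ℝ}

theorem measurable_uncurry (hg : IsRegularProcess g P) : Measurable (Function.uncurry g) :=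
  measurable_uncurry_of_continuous_of_measurable hg.continuous hg.measurable

theorem memLp (hg : IsRegularProcess g P) {t : ℝ} (ht : 0 ≤ t) : MemLp (g t) 2 P := by
  obtain ⟨C, hC⟩ := hg.bounded t
  exact (hC t ⟨ht, le_rfl⟩).1

theorem mul_deterministic (hg : IsRegularProcess g P) {k : ℝ → ℝ} (hk : Continuous k) :
    IsRegularProcess (fun u ω => k u * g u ω) P where
  measurable u := (hg.measurable u).const_mul _
  continuous ω := hk.mul (hg.continuous ω)
  bounded t := by
    obtain ⟨C, hC⟩ := hg.bounded t
    obtain ⟨D, hD⟩ := (isCompact_Icc (a := (0 : ℝ)) (b := t)).exists_bound_of_continuousOn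
      (f := fun u => k u ^ 2) (by fun_prop)
    refine ⟨D * C, fun u hu => ⟨(hC u hu).1.const_mul _, ?_⟩⟩
    simp only [mul_pow]
    rw [integral_const_mul]
    have h1 := hD u hu
    rw [Real.norm_of_nonneg (sq_nonneg _)] at h1
    exact mul_le_mul h1 (hC u hu).2 (integral_nonneg fun ω => sq_nonneg _)
      ((sq_nonneg _).trans h1)

theorem const_mul (hg : IsRegularProcess g P) (c : ℝ) :
    IsRegularProcess (fun u ω => c * g u ω) P :=
  hg.mul_deterministic continuous_const

theorem deterministic [IsProbabilityMeasure P] {k : ℝ → ℝ} (hk : Continuous k) :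
    IsRegularProcess (fun u (_ : Ω) => k u) P where
  measurable _ := measurable_const
  continuous _ := hk
  bounded t := by
    obtain ⟨D, hD⟩ := (isCompact_Icc (a := (0 : ℝ)) (b := t)).exists_bound_of_continuousOn
      (f := fun u => k u ^ 2) (by fun_prop)
    refine ⟨D, fun u hu => ⟨memLp_const _, ?_⟩⟩
    have h1 := hD u hu
    rw [Real.norm_of_nonneg (sq_nonneg _)] at h1
    simpa using h1

theorem add (hf : IsRegularProcess f P) (hg : IsRegularProcess g P) :
    IsRegularProcess (fun u ω => f u ω + g u ω) P where
  measurable u := (hf.measurable u).add (hg.measurable u)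
  continuous ω := (hf.continuous ω).add (hg.continuous ω)
  bounded t := by
    obtain ⟨C, hC⟩ := hf.bounded t
    obtain ⟨D, hD⟩ := hg.bounded t
    refine ⟨2 * C + 2 * D, fun u hu => ⟨(hC u hu).1.add (hD u hu).1, ?_⟩⟩
    have i1 := ((hC u hu).1.integrable_sq).const_mul 2
    have i2 := ((hD u hu).1.integrable_sq).const_mul 2
    calc ∫ ω, (f u ω + g u ω) ^ 2 ∂P ≤ ∫ ω, (2 * f u ω ^ 2 + 2 * g u ω ^ 2) ∂P := by
          refine integral_mono ((hC u hu).1.add (hD u hu).1).integrable_sq (i1.add i2) fun ω => ?_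
          simp only
          nlinarith [sq_nonneg (f u ω - g u ω)]
      _ ≤ 2 * C + 2 * D := by
          rw [integral_add i1 i2, integral_const_mul, integral_const_mul]
          linarith [(hC u hu).2, (hD u hu).2]

theorem sub (hf : IsRegularProcess f P) (hg : IsRegularProcess g P) :
    IsRegularProcess (fun u ω => f u ω - g u ω) P := by
  have := hf.add (hg.const_mul (-1))
  simpa only [neg_one_mul, ← sub_eq_add_neg] using this

theorem sq_of_isCenteredGaussian (hg : IsRegularProcess g P)
    (h : ∀ u, 0 ≤ u → IsCenteredGaussian (g u) P) : IsRegularProcess (fun u ω => g u ω ^ 2) P where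
  measurable u := (hg.measurable u).pow_const 2
  continuous ω := (hg.continuous ω).pow 2
  bounded t := by
    obtain ⟨C, hC⟩ := hg.bounded t
    refine ⟨3 * C ^ 2, fun u hu => ⟨(h u hu.1).memLp_sq, ?_⟩⟩
    simp only [← pow_mul]
    rw [(h u hu.1).integral_pow_four]
    have h0 : 0 ≤ ∫ ω, g u ω ^ 2 ∂P := integral_nonneg fun ω => sq_nonneg _
    have := (hC u hu).2
    gcongr

variable [IsProbabilityMeasure P]

theorem integrable_prod_sq (hg : IsRegularProcess g P) (t : ℝ) :
    Integrable (Function.uncurry fun u ω => g u ω ^ 2) ((volume.restrict (Set.Ioc 0 t)).prod P) := by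
  obtain ⟨C, hC⟩ := hg.bounded t
  have hm : Measurable (Function.uncurry fun u ω => g u ω ^ 2) := hg.measurable_uncurry.pow_const 2
  refine (integrable_prod_iff hm.aestronglyMeasurable).2 ⟨?_, ?_⟩
  · refine (ae_restrict_iff' measurableSet_Ioc).2 (ae_of_all _ fun u hu => ?_)
    exact (hC u ⟨hu.1.le, hu.2⟩).1.integrable_sq
  · refine Integrable.of_bound (C := C) ?_ ?_
    · exact (hm.norm.stronglyMeasurable.integral_prod_right).aestronglyMeasurable
    · refine (ae_restrict_iff' measurableSet_Ioc).2 (ae_of_all _ fun u hu => ?_)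
      rw [Real.norm_of_nonneg (integral_nonneg fun ω => norm_nonneg _)]
      simpa [Function.uncurry] using (hC u ⟨hu.1.le, hu.2⟩).2

theorem integrable_prod_mul (hg : IsRegularProcess g P) (t : ℝ) {Z : Ω → ℝ} (hZ : MemLp Z 2 P) :
    Integrable (Function.uncurry fun u ω => Z ω * g u ω)
      ((volume.restrict (Set.Ioc 0 t)).prod P) := by
  have h1 : MemLp (Function.uncurry g) 2 ((volume.restrict (Set.Ioc 0 t)).prod P) :=
    (memLp_two_iff_integrable_sq hg.measurable_uncurry.aestronglyMeasurable).2
      (hg.integrable_prod_sq t)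
  have h2 : MemLp (fun p : ℝ × Ω => Z p.2) 2 ((volume.restrict (Set.Ioc 0 t)).prod P) := by
    exact hZ.comp_snd _
  exact h2.integrable_mul h1

/-- The integral of a regular process is square integrable, with the bound given by the
Cauchy-Schwarz inequality. -/
theorem memLp_integral (hg : IsRegularProcess g P) {t : ℝ} (ht : 0 ≤ t) :
    MemLp (fun ω => ∫ u in (0 : ℝ)..t, g u ω) 2 P ∧
      ∀ C, (∀ u ∈ Set.Icc 0 t, ∫ ω, g u ω ^ 2 ∂P ≤ C) →
        ∫ ω, (∫ u in (0 : ℝ)..t, g u ω) ^ 2 ∂P ≤ t * (t * C) := by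
  have hm : Measurable fun ω => ∫ u in (0 : ℝ)..t, g u ω := by
    simp only [intervalIntegral.integral_of_le ht]
    exact (hg.measurable_uncurry.stronglyMeasurable.integral_prod_left).measurable
  have hsq := hg.integrable_prod_sq t
  have hi : Integrable (fun ω => t * ∫ u in (0 : ℝ)..t, g u ω ^ 2) P := by
    simp only [intervalIntegral.integral_of_le ht]
    exact (hsq.integral_prod_right).const_mul t
  have hle : ∀ ω, (∫ u in (0 : ℝ)..t, g u ω) ^ 2 ≤ t * ∫ u in (0 : ℝ)..t, g u ω ^ 2 :=
    fun ω => sq_intervalIntegral_le (hg.continuous ω) ht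
  have hi2 : Integrable (fun ω => (∫ u in (0 : ℝ)..t, g u ω) ^ 2) P := by
    refine hi.mono' (hm.pow_const 2).aestronglyMeasurable (ae_of_all _ fun ω => ?_)
    rw [Real.norm_of_nonneg (sq_nonneg _)]
    exact hle ω
  refine ⟨(memLp_two_iff_integrable_sq hm.aestronglyMeasurable).2 hi2, fun C hC => ?_⟩
  refine (integral_mono hi2 hi hle).trans ?_
  rw [integral_const_mul]
  refine mul_le_mul_of_nonneg_left ?_ ht
  simp only [intervalIntegral.integral_of_le ht]
  rw [← integral_integral_swap hsq]
  calc ∫ u in Set.Ioc 0 t, ∫ ω, g u ω ^ 2 ∂P ≤ ∫ _u in Set.Ioc 0 t, C := by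
        refine setIntegral_mono_on hsq.integral_prod_left (by simp) measurableSet_Ioc fun u hu => ?_
        exact hC u ⟨hu.1.le, hu.2⟩
    _ = t * C := by simp [ht]

/-- Expectation and time integral commute. -/
theorem integral_mul_integral (hg : IsRegularProcess g P) {t : ℝ} (ht : 0 ≤ t) {Z : Ω → ℝ}
    (hZ : MemLp Z 2 P) :
    ∫ ω, Z ω * (∫ u in (0 : ℝ)..t, g u ω) ∂P = ∫ u in (0 : ℝ)..t, ∫ ω, Z ω * g u ω ∂P := by
  simp only [intervalIntegral.integral_of_le ht, ← integral_const_mul]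
  exact (integral_integral_swap (hg.integrable_prod_mul t hZ)).symm

theorem integral_integral (hg : IsRegularProcess g P) {t : ℝ} (ht : 0 ≤ t) :
    ∫ ω, (∫ u in (0 : ℝ)..t, g u ω) ∂P = ∫ u in (0 : ℝ)..t, ∫ ω, g u ω ∂P := by
  simpa using hg.integral_mul_integral ht (memLp_const (1 : ℝ))

/-- Covariance and time integral commute. -/
theorem covariance_integral (hg : IsRegularProcess g P) {t : ℝ} (ht : 0 ≤ t) {Z : Ω → ℝ}
    (hZ : MemLp Z 2 P) :
    cov[Z, fun ω => ∫ u in (0 : ℝ)..t, g u ω; P] = ∫ u in (0 : ℝ)..t, cov[Z, g u; P] := by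
  -- Centering `Z` turns the covariance into `E[Zc B]`, which is linear in `B` and falls under
  -- `integral_mul_integral`.
  set Zc : Ω → ℝ := fun ω => Z ω - ∫ ω, Z ω ∂P with hZc
  have hZcLp : MemLp Zc 2 P := hZ.sub (memLp_const _)
  have hZcMean : ∫ ω, Zc ω ∂P = 0 := by
    rw [hZc, integral_sub (hZ.integrable (by norm_num)) (integrable_const _)]
    simp
  have key : ∀ {B : Ω → ℝ}, MemLp B 2 P → cov[Z, B; P] = ∫ ω, Zc ω * B ω ∂P := by
    intro B hB
    have h1 : cov[Z, B; P] = cov[Zc, B; P] :=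
      (covariance_sub_const_left (hZ.integrable (by norm_num)) _).symm
    rw [h1, covariance_eq_sub hZcLp hB, hZcMean]
    simp
  rw [key (hg.memLp_integral ht).1, hg.integral_mul_integral ht hZcLp]
  refine intervalIntegral.integral_congr fun u hu => ?_
  rw [Set.uIcc_of_le ht] at hu
  exact (key (hg.memLp hu.1)).symm

theorem integral (hg : IsRegularProcess g P) :
    IsRegularProcess (fun t ω => ∫ u in (0 : ℝ)..t, g u ω) P where
  measurable t := by
    simp only [intervalIntegral]
    exact (hg.measurable_uncurry.stronglyMeasurable.integral_prod_left).measurable.sub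
      (hg.measurable_uncurry.stronglyMeasurable.integral_prod_left).measurable
  continuous ω := intervalIntegral.continuous_primitive
    (fun a b => (hg.continuous ω).intervalIntegrable a b) 0
  bounded t := by
    obtain ⟨C, hC⟩ := hg.bounded t
    refine ⟨t * (t * |C|), fun u hu => ⟨(hg.memLp_integral hu.1).1, ?_⟩⟩
    refine ((hg.memLp_integral hu.1).2 |C| fun r hr =>
      ((hC r ⟨hr.1, hr.2.trans hu.2⟩).2.trans (le_abs_self C))).trans ?_
    have h0 := hu.1
    have h1 := hu.2
    have h2 := h0.trans h1
    gcongr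

/-- A variable orthogonal to the span is orthogonal to every `g u`, hence by Fubini to the integral.
This avoids Riemann sums and vector-valued integrals. -/
theorem inClosedSpan_integral {ι : Type*} {X : ι → Ω → ℝ} (hg : IsRegularProcess g P)
    (h : ∀ u, 0 ≤ u → InClosedSpan X P (g u)) {t : ℝ} (ht : 0 ≤ t) :
    InClosedSpan X P (fun ω => ∫ u in (0 : ℝ)..t, g u ω) := by
  refine InClosedSpan.of_forall_orthogonal (hg.memLp_integral ht).1 fun Z hZ hort => ?_
  rw [hg.integral_mul_integral ht hZ]
  have : Set.EqOn (fun u => ∫ ω, Z ω * g u ω ∂P) (fun _ => 0) (Set.uIcc 0 t) := by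
    intro u hu
    rw [Set.uIcc_of_le ht] at hu
    exact hort _ (h u hu.1)
  rw [intervalIntegral.integral_congr this]
  simp

end IsRegularProcess

end RegularProcess

/-! ### Variation of constants and exponential integrals. -/

section LinearEquation

/-- `∫₀ˢ exp (c q) dq`. -/
noncomputable def expIntegral (c s : ℝ) : ℝ := ∫ q in (0 : ℝ)..s, Real.exp (c * q)

theorem hasDerivAt_expIntegral (c s : ℝ) :
    HasDerivAt (expIntegral c) (Real.exp (c * s)) s :=
  intervalIntegral.integral_hasDerivAt_right (Continuous.intervalIntegrable (by fun_prop) _ _)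
    (Continuous.stronglyMeasurableAtFilter (by fun_prop) _ _)
    (Continuous.continuousAt (by fun_prop))

@[fun_prop]
theorem continuous_expIntegral (c : ℝ) : Continuous (expIntegral c) :=
  continuous_iff_continuousAt.2 fun s => (hasDerivAt_expIntegral c s).continuousAt

@[simp]
theorem expIntegral_zero_right (c : ℝ) : expIntegral c 0 = 0 := by simp [expIntegral]

theorem hasDerivAt_exp_mul (c s : ℝ) :
    HasDerivAt (fun q => Real.exp (c * q)) (c * Real.exp (c * s)) s := by
  have := ((hasDerivAt_id s).const_mul c).exp
  simp only [id, mul_one] at this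
  exact this.congr_deriv (mul_comm _ _)

/-- Free of division, hence valid at `c = 0`. Thanks to this form the Ornstein-Uhlenbeck covariances
hold for all rates, and nonzero denominators are assumed only later. -/
theorem mul_expIntegral (c s : ℝ) : c * expIntegral c s = Real.exp (c * s) - 1 := by
  rw [expIntegral, ← intervalIntegral.integral_const_mul,
    intervalIntegral.integral_eq_sub_of_hasDerivAt (fun q _ => hasDerivAt_exp_mul c q)
      (Continuous.intervalIntegrable (by fun_prop) _ _)]
  simp

theorem expIntegral_eq {c : ℝ} (hc : c ≠ 0) (s : ℝ) :
    expIntegral c s = (Real.exp (c * s) - 1) / c := by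
  rw [eq_div_iff hc, mul_comm, mul_expIntegral]

/-- Variation of constants for a linear equation with additive continuous noise. -/
theorem linear_equation_solution {a x₀ : ℝ} {x f w : ℝ → ℝ} (hx : Continuous x)
    (hf : Continuous f) (hw : Continuous w)
    (h : ∀ t, 0 ≤ t → x t = x₀ + (∫ u in (0 : ℝ)..t, (f u - a * x u)) + w t) {t : ℝ}
    (ht : 0 ≤ t) :
    x t = Real.exp (-a * t) * x₀ + Real.exp (-a * t) * (∫ u in (0 : ℝ)..t, Real.exp (a * u) * f u)
      + (w t - a * (Real.exp (-a * t) * ∫ u in (0 : ℝ)..t, Real.exp (a * u) * w u)) := by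
  -- `z = x - w` is differentiable even when the noise `w` is not. Integrating the derivative of
  -- `exp (a u) z u` and substituting `x = z + w` eliminates `x` from the integral.
  set z : ℝ → ℝ := fun t => x₀ + ∫ u in (0 : ℝ)..t, (f u - a * x u) with hz
  have hc : Continuous fun u => f u - a * x u := by fun_prop
  have hzd : ∀ u, HasDerivAt z (f u - a * x u) u := fun u =>
    (intervalIntegral.integral_hasDerivAt_right (hc.intervalIntegrable _ _)
      (hc.stronglyMeasurableAtFilter _ _) hc.continuousAt).const_add x₀
  have hzc : Continuous z := continuous_iff_continuousAt.2 fun u => (hzd u).continuousAt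
  have hftc := intervalIntegral.integral_eq_sub_of_hasDerivAt (a := 0) (b := t)
    (fun u _ => (hasDerivAt_exp_mul a u).mul (hzd u))
    (Continuous.intervalIntegrable (by fun_prop) _ _)
  have hcongr : ∫ u in (0 : ℝ)..t,
      (a * Real.exp (a * u) * z u + Real.exp (a * u) * (f u - a * x u)) =
        ∫ u in (0 : ℝ)..t, (Real.exp (a * u) * f u - a * (Real.exp (a * u) * w u)) := by
    refine intervalIntegral.integral_congr fun u hu => ?_
    rw [Set.uIcc_of_le ht] at hu
    linear_combination (-a * Real.exp (a * u)) * h u hu.1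
  rw [hcongr, intervalIntegral.integral_sub (Continuous.intervalIntegrable (by fun_prop) _ _)
    (Continuous.intervalIntegrable (by fun_prop) _ _), intervalIntegral.integral_const_mul] at hftc
  have hz0 : z 0 = x₀ := by simp [hz]
  have hxt : x t = z t + w t := h t ht
  have he : Real.exp (-a * t) * Real.exp (a * t) = 1 := by rw [← Real.exp_add]; simp
  simp only [Pi.mul_apply, mul_zero, Real.exp_zero, one_mul, hz0] at hftc
  have : z t = Real.exp (-a * t) * (Real.exp (a * t) * z t) := by rw [← mul_assoc, he, one_mul]
  rw [hxt, this, sub_eq_iff_eq_add.1 hftc.symm]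
  ring

theorem mul_integral_exp_mul_min {b s t : ℝ} (hs : 0 ≤ s) (hst : s ≤ t) :
    b * ∫ u in (0 : ℝ)..t, Real.exp (b * u) * min s u = s * Real.exp (b * t) - expIntegral b s := by
  rw [← intervalIntegral.integral_add_adjacent_intervals (b := s)
    (Continuous.intervalIntegrable (by fun_prop) _ _)
    (Continuous.intervalIntegrable (by fun_prop) _ _), mul_add,
    ← intervalIntegral.integral_const_mul, ← intervalIntegral.integral_const_mul]
  have h1 : ∫ u in (0 : ℝ)..s, b * (Real.exp (b * u) * min s u) =
      s * Real.exp (b * s) - expIntegral b s := by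
    have hd : ∀ u ∈ Set.uIcc 0 s, HasDerivAt (fun u => u * Real.exp (b * u) - expIntegral b u)
        (b * (Real.exp (b * u) * u)) u := fun u _ =>
      (((hasDerivAt_id u).mul (hasDerivAt_exp_mul b u)).sub
        (hasDerivAt_expIntegral b u)).congr_deriv (by simp only [id]; ring)
    have := intervalIntegral.integral_eq_sub_of_hasDerivAt hd
      (Continuous.intervalIntegrable (by fun_prop) _ _)
    simp only [zero_mul, expIntegral_zero_right, sub_zero] at this
    rw [← this]
    refine intervalIntegral.integral_congr fun u hu => ?_
    rw [Set.uIcc_of_le hs] at hu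
    simp only [min_eq_right hu.2]
  have h2 : ∫ u in s..t, b * (Real.exp (b * u) * min s u) =
      s * Real.exp (b * t) - s * Real.exp (b * s) := by
    have hd : ∀ u ∈ Set.uIcc s t, HasDerivAt (fun u => s * Real.exp (b * u))
        (b * (Real.exp (b * u) * s)) u := fun u _ =>
      ((hasDerivAt_exp_mul b u).const_mul s).congr_deriv (by ring)
    rw [← intervalIntegral.integral_eq_sub_of_hasDerivAt hd
      (Continuous.intervalIntegrable (by fun_prop) _ _)]
    refine intervalIntegral.integral_congr fun u hu => ?_
    rw [Set.uIcc_of_le hst] at hu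
    simp only [min_eq_left hu.1]
  rw [h1, h2]
  ring

theorem mul_integral_exp_mul_expIntegral (a b s : ℝ) :
    a * ∫ u in (0 : ℝ)..s, Real.exp (a * u) * expIntegral b u =
      Real.exp (a * s) * expIntegral b s - expIntegral (a + b) s := by
  have hd : ∀ u ∈ Set.uIcc 0 s, HasDerivAt
      (fun u => Real.exp (a * u) * expIntegral b u - expIntegral (a + b) u)
      (a * (Real.exp (a * u) * expIntegral b u)) u := fun u _ =>
    (((hasDerivAt_exp_mul a u).mul (hasDerivAt_expIntegral b u)).sub
      (hasDerivAt_expIntegral (a + b) u)).congr_deriv (by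
        rw [add_mul, Real.exp_add]; ring)
  rw [← intervalIntegral.integral_const_mul, intervalIntegral.integral_eq_sub_of_hasDerivAt hd
      (Continuous.intervalIntegrable (by fun_prop) _ _)]
  simp

end LinearEquation

/-! ### Ornstein-Uhlenbeck processes as pathwise functionals of the noise. -/

section OrnsteinUhlenbeck

variable {Ω : Type*} [MeasurableSpace Ω] {P : Measure Ω}

/-- The solution of `dY = -a Y dt + dW` that starts at `0`. -/
noncomputable def ornsteinUhlenbeck (a : ℝ) (W : ℝ → Ω → ℝ) (t : ℝ) (ω : Ω) : ℝ :=
  W t ω - a * (Real.exp (-a * t) * ∫ u in (0 : ℝ)..t, Real.exp (a * u) * W u ω)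

variable [IsProbabilityMeasure P] {W W₁ W₂ : ℝ → Ω → ℝ}

theorem IsRegularProcess.ornsteinUhlenbeck (hW : IsRegularProcess W P) (a : ℝ) :
    IsRegularProcess (ornsteinUhlenbeck a W) P :=
  hW.sub (((hW.mul_deterministic (by fun_prop)).integral.mul_deterministic
    (by fun_prop)).const_mul a)

theorem InClosedSpan.ornsteinUhlenbeck {ι : Type*} {X : ι → Ω → ℝ} (hW : IsRegularProcess W P)
    (h : ∀ u, 0 ≤ u → InClosedSpan X P (W u)) (a : ℝ) {t : ℝ} (ht : 0 ≤ t) :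
    InClosedSpan X P (ornsteinUhlenbeck a W t) :=
  (h t ht).sub ((((hW.mul_deterministic (k := fun u => Real.exp (a * u))
    (by fun_prop)).inClosedSpan_integral
    (fun u hu => (h u hu).const_mul _) ht).const_mul _).const_mul a)

theorem covariance_ornsteinUhlenbeck_right (hW : IsRegularProcess W P) {Z : Ω → ℝ}
    (hZ : MemLp Z 2 P) (a : ℝ) {t : ℝ} (ht : 0 ≤ t) :
    cov[Z, ornsteinUhlenbeck a W t; P] = cov[Z, W t; P] -
      a * (Real.exp (-a * t) * ∫ u in (0 : ℝ)..t, Real.exp (a * u) * cov[Z, W u; P]) := by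
  have hr : IsRegularProcess (fun u ω => Real.exp (a * u) * W u ω) P :=
    hW.mul_deterministic (by fun_prop)
  have h2 := ((hr.memLp_integral ht).1.const_mul (Real.exp (-a * t))).const_mul a
  unfold ornsteinUhlenbeck
  rw [covariance_fun_sub_right hZ (hW.memLp ht) h2, covariance_const_mul_right,
    covariance_const_mul_right, hr.covariance_integral ht hZ]
  simp only [covariance_const_mul_right]

/-- The covariance of two Ornstein-Uhlenbeck processes driven by correlated Brownian motions. -/
theorem covariance_ornsteinUhlenbeck (hW₁ : IsRegularProcess W₁ P) (hW₂ : IsRegularProcess W₂ P)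
    {ρ : ℝ} (hcov : ∀ u t, 0 ≤ u → 0 ≤ t → cov[W₁ u, W₂ t; P] = ρ * min u t) (a b : ℝ) {s t : ℝ}
    (hs : 0 ≤ s) (hst : s ≤ t) :
    cov[ornsteinUhlenbeck a W₁ s, ornsteinUhlenbeck b W₂ t; P] =
      ρ * (Real.exp (-a * s) * Real.exp (-b * t) * expIntegral (a + b) s) := by
  have ht := hs.trans hst
  -- The process with the later time is expanded first, against the Brownian value at `r ≤ t`.
  -- Expanding the other process then needs these covariances only for `r ≤ s`.
  have h1 : ∀ r, 0 ≤ r → r ≤ t → cov[ornsteinUhlenbeck b W₂ t, W₁ r; P] =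
      ρ * Real.exp (-b * t) * expIntegral b r := by
    intro r hr hrt
    have he : Real.exp (-b * t) * Real.exp (b * t) = 1 := by rw [← Real.exp_add]; simp
    have hi : ∫ u in (0 : ℝ)..t, Real.exp (b * u) * cov[W₁ r, W₂ u; P] =
        ρ * ∫ u in (0 : ℝ)..t, Real.exp (b * u) * min r u := by
      rw [← intervalIntegral.integral_const_mul]
      refine intervalIntegral.integral_congr fun u hu => ?_
      rw [Set.uIcc_of_le ht] at hu
      simp only [hcov r u hr hu.1]
      ring
    rw [covariance_comm, covariance_ornsteinUhlenbeck_right hW₂ (hW₁.memLp hr) b ht,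
      hcov r t hr ht, hi, min_eq_left hrt]
    linear_combination (-ρ * Real.exp (-b * t)) * mul_integral_exp_mul_min (b := b) hr hrt -
      ρ * r * he
  have hi : ∫ u in (0 : ℝ)..s, Real.exp (a * u) * cov[ornsteinUhlenbeck b W₂ t, W₁ u; P] =
      ρ * Real.exp (-b * t) * ∫ u in (0 : ℝ)..s, Real.exp (a * u) * expIntegral b u := by
    rw [← intervalIntegral.integral_const_mul]
    refine intervalIntegral.integral_congr fun u hu => ?_
    rw [Set.uIcc_of_le hs] at hu
    simp only [h1 u hu.1 (hu.2.trans hst)]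
    ring
  have he : Real.exp (-a * s) * Real.exp (a * s) = 1 := by rw [← Real.exp_add]; simp
  rw [covariance_comm, covariance_ornsteinUhlenbeck_right hW₁ ((hW₂.ornsteinUhlenbeck b).memLp ht)
    a hs, h1 s hs hst, hi]
  linear_combination (-ρ * Real.exp (-b * t) * Real.exp (-a * s)) *
    mul_integral_exp_mul_expIntegral a b s -
      ρ * Real.exp (-b * t) * expIntegral b s * he

end OrnsteinUhlenbeck

/-! ### Continuous modifications with measurable marginals. -/

section Modification

variable {Ω : Type*} [MeasurableSpace Ω] {P : Measure Ω}

/-- A process with almost surely continuous paths is almost surely equal to a process with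
measurable marginals all of whose paths are continuous. -/
theorem exists_continuous_measurable_modification {W : ℝ≥0 → Ω → ℝ}
    (hm : ∀ t, AEMeasurable (W t) P) (hc : ∀ᵐ ω ∂P, Continuous fun t => W t ω) :
    ∃ U : ℝ → Ω → ℝ, (∀ u, Measurable (U u)) ∧ (∀ ω, Continuous fun u => U u ω) ∧
      ∀ᵐ ω ∂P, ∀ u : ℝ≥0, U u ω = W u ω := by
  classical
  set d := TopologicalSpace.denseSeq ℝ≥0
  -- Off one null set the path is continuous and agrees with measurable versions at countably many
  -- dense times. Setting the process to `0` on a measurable null superset makes every marginal a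
  -- limit of measurable functions.
  have hgood : ∀ᵐ ω ∂P, Continuous (fun t => W t ω) ∧ ∀ n, W (d n) ω = (hm (d n)).mk _ ω :=
    hc.and (ae_all_iff.2 fun n => (hm (d n)).ae_eq_mk)
  obtain ⟨N, hN, hNm, hN0⟩ := exists_measurable_superset_of_null (ae_iff.1 hgood)
  have hout : ∀ ω, ω ∉ N →
      Continuous (fun t => W t ω) ∧ ∀ n, W (d n) ω = (hm (d n)).mk _ ω := by
    intro ω hω
    by_contra hcon
    exact hω (hN hcon)
  refine ⟨fun u ω => if ω ∈ N then 0 else W u.toNNReal ω, fun u => ?_, fun ω => ?_, ?_⟩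
  · obtain ⟨x, hx, hxu⟩ := mem_closure_iff_seq_limit.1
      (TopologicalSpace.denseRange_denseSeq ℝ≥0 u.toNNReal)
    choose φ hφ using hx
    refine measurable_of_tendsto_metrizable
      (f := fun k ω => if ω ∈ N then 0 else (hm (d (φ k))).mk _ ω) (fun k => ?_) ?_
    · exact Measurable.ite hNm measurable_const (hm _).measurable_mk
    · refine tendsto_pi_nhds.2 fun ω => ?_
      by_cases hω : ω ∈ N
      · simp [hω]
      · simp only [hω, if_false]
        have h1 := ((hout ω hω).1.tendsto u.toNNReal).comp hxu
        refine h1.congr fun k => ?_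
        rw [Function.comp_apply, ← hφ k]
        exact (hout ω hω).2 _
  · by_cases hω : ω ∈ N
    · simp only [hω, if_true]
      exact continuous_const
    · simp only [hω, if_false]
      exact (hout ω hω).1.comp continuous_real_toNNReal
  · have : ∀ᵐ ω ∂P, ω ∉ N := measure_eq_zero_iff_ae_notMem.1 hN0
    filter_upwards [this] with ω hω u
    simp [hω]

end Modification

/-! ### Deterministic integrals of exponentials and of symmetric kernels. -/

section DeterministicIntegrals

theorem integral_three_exp (a b c k l m t : ℝ) :
    ∫ u in (0 : ℝ)..t, (a * Real.exp (k * u) + b * Real.exp (l * u) + c * Real.exp (m * u)) =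
      a * expIntegral k t + b * expIntegral l t + c * expIntegral m t := by
  rw [intervalIntegral.integral_add (Continuous.intervalIntegrable (by fun_prop) _ _)
    (Continuous.intervalIntegrable (by fun_prop) _ _),
    intervalIntegral.integral_add (Continuous.intervalIntegrable (by fun_prop) _ _)
    (Continuous.intervalIntegrable (by fun_prop) _ _), intervalIntegral.integral_const_mul,
    intervalIntegral.integral_const_mul, intervalIntegral.integral_const_mul]
  rfl

theorem integral_exp_mul_expIntegral {k : ℝ} (hk : k ≠ 0) (c t : ℝ) :
    ∫ r in (0 : ℝ)..t, Real.exp (c * r) * expIntegral k r =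
      (expIntegral (c + k) t - expIntegral c t) / k := by
  have h := integral_three_exp (1 / k) (-1 / k) 0 (c + k) c 0 t
  have e : ∀ r, Real.exp (c * r) * expIntegral k r =
      1 / k * Real.exp ((c + k) * r) + -1 / k * Real.exp (c * r) + 0 * Real.exp (0 * r) := by
    intro r
    rw [expIntegral_eq hk, add_mul, Real.exp_add]
    ring
  simp only [e]
  rw [h]
  ring

/-- The integral over a square of a symmetric kernel of the form `α (min u r) * ψ (max u r)`. -/
theorem integral_symm_kernel_square {α ψ : ℝ → ℝ} (hα : Continuous α) (hψ : Continuous ψ)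
    {F : ℝ → ℝ → ℝ} (hF : ∀ u r, 0 ≤ u → u ≤ r → F u r = α u * ψ r)
    (hsymm : ∀ u r, F u r = F r u) {t : ℝ} (ht : 0 ≤ t) :
    ∫ r in (0 : ℝ)..t, ∫ u in (0 : ℝ)..t, F u r =
      2 * ∫ r in (0 : ℝ)..t, ψ r * ∫ u in (0 : ℝ)..r, α u := by
  set A : ℝ → ℝ := fun r => ∫ u in (0 : ℝ)..r, α u with hA
  set B : ℝ → ℝ := fun r => ∫ u in (0 : ℝ)..r, ψ u with hB
  have hAd : ∀ r, HasDerivAt A (α r) r := fun r =>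
    intervalIntegral.integral_hasDerivAt_right (hα.intervalIntegrable _ _)
      (hα.stronglyMeasurableAtFilter _ _) hα.continuousAt
  have hBd : ∀ r, HasDerivAt B (ψ r) r := fun r =>
    intervalIntegral.integral_hasDerivAt_right (hψ.intervalIntegrable _ _)
      (hψ.stronglyMeasurableAtFilter _ _) hψ.continuousAt
  have hAc : Continuous A := continuous_iff_continuousAt.2 fun r => (hAd r).continuousAt
  have hBc : Continuous B := continuous_iff_continuousAt.2 fun r => (hBd r).continuousAt
  have inner : ∀ r ∈ Set.uIcc 0 t, ∫ u in (0 : ℝ)..t, F u r = A r * ψ r + α r * (B t - B r) := by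
    intro r hr
    rw [Set.uIcc_of_le ht] at hr
    have e1 : Set.EqOn (fun u => F u r) (fun u => α u * ψ r) (Set.uIcc 0 r) := by
      intro u hu
      rw [Set.uIcc_of_le hr.1] at hu
      exact hF u r hu.1 hu.2
    have e2 : Set.EqOn (fun u => F u r) (fun u => α r * ψ u) (Set.uIcc r t) := by
      intro u hu
      rw [Set.uIcc_of_le hr.2] at hu
      simp only
      rw [hsymm, hF r u hr.1 hu.1]
    have c1 : Continuous fun u => α u * ψ r := by fun_prop
    have c2 : Continuous fun u => α r * ψ u := by fun_prop
    rw [← intervalIntegral.integral_add_adjacent_intervals (b := r)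
      ((intervalIntegrable_congr (e1.symm.mono Set.uIoc_subset_uIcc)).1 (c1.intervalIntegrable 0 r))
      ((intervalIntegrable_congr (e2.symm.mono Set.uIoc_subset_uIcc)).1 (c2.intervalIntegrable r t)),
      intervalIntegral.integral_congr e1, intervalIntegral.integral_congr e2,
      intervalIntegral.integral_mul_const, intervalIntegral.integral_const_mul,
      intervalIntegral.integral_interval_sub_left (hψ.intervalIntegrable _ _)
        (hψ.intervalIntegrable _ _)]
  -- The inner integral differs from `2 ψ A` by the derivative of `A r (B t - B r)`, which vanishes
  -- at both ends because `A 0 = 0`.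
  have hd : ∀ r ∈ Set.uIcc 0 t, HasDerivAt (fun r => A r * (B t - B r))
      (A r * ψ r + α r * (B t - B r) - 2 * (ψ r * A r)) r := fun r _ =>
    ((hAd r).mul ((hBd r).const_sub (B t))).congr_deriv (by ring)
  have hftc := intervalIntegral.integral_eq_sub_of_hasDerivAt hd
    (Continuous.intervalIntegrable (by fun_prop) _ _)
  rw [intervalIntegral.integral_sub (Continuous.intervalIntegrable (by fun_prop) _ _)
    (Continuous.intervalIntegrable (by fun_prop) _ _), intervalIntegral.integral_const_mul] at hftc
  have hA0 : A 0 = 0 := by simp [hA]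
  rw [hA0] at hftc
  rw [intervalIntegral.integral_congr inner]
  linarith

end DeterministicIntegrals

/-! ### Covariances of squares of Gaussian variables. -/

section QuadraticCovariance

variable {Ω : Type*} [MeasurableSpace Ω] {P : Measure Ω}

/-- Two random variables that are centered Gaussian together with their sum and difference. -/
structure IsCenteredGaussianPair (A B : Ω → ℝ) (P : Measure Ω) : Prop where
  left : IsCenteredGaussian A P
  right : IsCenteredGaussian B P
  add : IsCenteredGaussian (fun ω => A ω + B ω) P
  sub : IsCenteredGaussian (fun ω => A ω - B ω) P

variable {A B : Ω → ℝ}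

theorem covariance_fun_add_left [IsFiniteMeasure P] {C : Ω → ℝ} (hA : MemLp A 2 P) (hB : MemLp B 2 P)
    (hC : MemLp C 2 P) : cov[fun ω => A ω + B ω, C; P] = cov[A, C; P] + cov[B, C; P] :=
  covariance_add_left hA hB hC

theorem covariance_fun_add_right [IsFiniteMeasure P] {C : Ω → ℝ} (hA : MemLp A 2 P) (hB : MemLp B 2 P)
    (hC : MemLp C 2 P) : cov[A, fun ω => B ω + C ω; P] = cov[A, B; P] + cov[A, C; P] :=
  covariance_add_right hA hB hC

namespace IsCenteredGaussianPair

theorem symm (h : IsCenteredGaussianPair A B P) : IsCenteredGaussianPair B A P where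
  left := h.right
  right := h.left
  add := by simpa only [add_comm] using h.add
  sub := by
    refine ⟨?_, ?_⟩
    · simpa using h.sub.gaussian.fun_neg
    · have := h.sub.mean
      rw [← neg_eq_zero, ← integral_neg] at this
      simpa using this

variable [IsProbabilityMeasure P]

theorem covariance_eq (h : IsCenteredGaussianPair A B P) :
    cov[A, B; P] = ∫ ω, A ω * B ω ∂P := by
  rw [covariance_eq_sub (h.left.memLp (by simp)) (h.right.memLp (by simp)), h.left.mean]
  simp

theorem covariance_sq_left (h : IsCenteredGaussianPair A B P) :
    cov[fun ω => A ω ^ 2, B; P] = 0 := by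
  rw [covariance_eq_sub h.left.memLp_sq (h.right.memLp (by simp)), h.right.mean]
  simpa using h.right.integral_sq_mul h.add h.sub

theorem covariance_sq_sq (h : IsCenteredGaussianPair A B P) :
    cov[fun ω => A ω ^ 2, fun ω => B ω ^ 2; P] = 2 * cov[A, B; P] ^ 2 := by
  rw [covariance_eq_sub h.left.memLp_sq h.right.memLp_sq, h.covariance_eq]
  have := h.left.integral_sq_mul_sq h.right h.add h.sub
  simp only [Pi.mul_apply]
  rw [this]
  ring

theorem covariance_affine_sq (h : IsCenteredGaussianPair A B P) (m σ : ℝ) :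
    cov[B, fun ω => (m + σ * A ω) ^ 2; P] = 2 * m * σ * cov[A, B; P] := by
  have e : (fun ω => (m + σ * A ω) ^ 2) =
      fun ω => m ^ 2 + ((2 * m * σ) * A ω + σ ^ 2 * A ω ^ 2) := by
    ext ω; ring
  have hA := h.left.memLp (p := 2) (by simp)
  have hB := h.right.memLp (p := 2) (by simp)
  have hi : MemLp (fun ω => (2 * m * σ) * A ω + σ ^ 2 * A ω ^ 2) 2 P :=
    (hA.const_mul _).add (h.left.memLp_sq.const_mul _)
  rw [e, covariance_const_add_right (hi.integrable (by norm_num)),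
    covariance_fun_add_right hB (hA.const_mul _) (h.left.memLp_sq.const_mul _),
    covariance_const_mul_right, covariance_const_mul_right, covariance_comm, covariance_comm B,
    h.covariance_sq_left]
  ring

/-- After expansion the mixed linear-quadratic terms are odd Gaussian moments and vanish; the
linear-linear and square-square terms remain. -/
theorem covariance_affine_sq_affine_sq (h : IsCenteredGaussianPair A B P) (m n σ : ℝ) :
    cov[fun ω => (m + σ * A ω) ^ 2, fun ω => (n + σ * B ω) ^ 2; P] =
      4 * m * n * σ ^ 2 * cov[A, B; P] + 2 * σ ^ 4 * cov[A, B; P] ^ 2 := by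
  have e : (fun ω => (m + σ * A ω) ^ 2) =
      fun ω => m ^ 2 + ((2 * m * σ) * A ω + σ ^ 2 * A ω ^ 2) := by
    ext ω; ring
  have eB : (fun ω => (n + σ * B ω) ^ 2) =
      fun ω => n ^ 2 + ((2 * n * σ) * B ω + σ ^ 2 * B ω ^ 2) := by
    ext ω; ring
  have hA := h.left.memLp (p := 2) (by simp)
  have hB := h.right.memLp (p := 2) (by simp)
  have hi : MemLp (fun ω => (2 * m * σ) * A ω + σ ^ 2 * A ω ^ 2) 2 P :=
    (hA.const_mul _).add (h.left.memLp_sq.const_mul _)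
  have hB2 : MemLp (fun ω => (n + σ * B ω) ^ 2) 2 P := by
    have hj := (memLp_const (μ := P) (p := 2) (n ^ 2)).add
      ((hB.const_mul (2 * n * σ)).add (h.right.memLp_sq.const_mul (σ ^ 2)))
    exact eB ▸ hj
  have h2 : cov[fun ω => A ω ^ 2, fun ω => (n + σ * B ω) ^ 2; P] =
      σ ^ 2 * (2 * cov[A, B; P] ^ 2) := by
    have hj : MemLp (fun ω => (2 * n * σ) * B ω + σ ^ 2 * B ω ^ 2) 2 P :=
      (hB.const_mul _).add (h.right.memLp_sq.const_mul _)
    rw [eB, covariance_const_add_right (hj.integrable (by norm_num)),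
      covariance_fun_add_right h.left.memLp_sq (hB.const_mul _) (h.right.memLp_sq.const_mul _),
      covariance_const_mul_right, covariance_const_mul_right, h.covariance_sq_left,
      h.covariance_sq_sq]
    ring
  rw [e, covariance_const_add_left (hi.integrable (by norm_num)),
    covariance_fun_add_left (hA.const_mul _) (h.left.memLp_sq.const_mul _) hB2,
    covariance_const_mul_left, covariance_const_mul_left, h.symm.covariance_affine_sq, h2,
    covariance_comm B A]
  ring

end IsCenteredGaussianPair

end QuadraticCovariance

/-! ### Representation of the solution by correlated Ornstein-Uhlenbeck processes. -/

section CorrelatedOrnsteinUhlenbeck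

variable {Ω : Type*} [MeasurableSpace Ω] {P : Measure Ω}

/-- `Y` and `N` are jointly Gaussian with the covariances of the Ornstein-Uhlenbeck processes
`dY = -lam Y dt + dWs`, `dN = -γ N dt + dWv` started at `0`, where `corr(dWs, dWv) = ρ`. -/
structure IsCorrelatedOU (lam γ ρ : ℝ) (Y N : ℝ → Ω → ℝ) (P : Measure Ω) : Prop where
  regular_Y : IsRegularProcess Y P
  regular_N : IsRegularProcess N P
  pair_YY : ∀ s t, 0 ≤ s → 0 ≤ t → IsCenteredGaussianPair (Y s) (Y t) P
  pair_YN : ∀ s t, 0 ≤ s → 0 ≤ t → IsCenteredGaussianPair (Y s) (N t) P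
  cov_YY : ∀ s t, 0 ≤ s → s ≤ t → cov[Y s, Y t; P] =
    Real.exp (-lam * s) * Real.exp (-lam * t) * expIntegral (lam + lam) s
  cov_YN : ∀ s t, 0 ≤ s → s ≤ t → cov[Y s, N t; P] =
    ρ * (Real.exp (-lam * s) * Real.exp (-γ * t) * expIntegral (lam + γ) s)
  cov_NN : ∀ t, 0 ≤ t → cov[N t, N t; P] =
    Real.exp (-γ * t) * Real.exp (-γ * t) * expIntegral (γ + γ) t

theorem covariance_congr {A A₁ B B₁ : Ω → ℝ} (hA : A =ᵐ[P] A₁) (hB : B =ᵐ[P] B₁) :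
    cov[A, B; P] = cov[A₁, B₁; P] := by
  rw [covariance, covariance, integral_congr_ae hA, integral_congr_ae hB]
  refine integral_congr_ae ?_
  filter_upwards [hA, hB] with ω h1 h2
  rw [h1, h2]

theorem IsRegularProcess.of_covariance [IsProbabilityMeasure P] {W : ℝ → Ω → ℝ}
    (hm : ∀ u, Measurable (W u)) (hc : ∀ ω, Continuous fun u => W u ω)
    (hg : ∀ u, 0 ≤ u → IsCenteredGaussian (W u) P)
    (hcov : ∀ u t, 0 ≤ u → 0 ≤ t → cov[W u, W t; P] = min u t) : IsRegularProcess W P where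
  measurable := hm
  continuous := hc
  bounded t := by
    refine ⟨t, fun u hu => ⟨(hg u hu.1).memLp (by simp), ?_⟩⟩
    have h := hcov u u hu.1 hu.1
    rw [covariance_self (hm u).aemeasurable,
      variance_of_integral_eq_zero (hm u).aemeasurable (hg u hu.1).mean, min_self] at h
    exact h.trans_le hu.2

theorem InClosedSpan.isCenteredGaussianPair [IsProbabilityMeasure P] {ι : Type*} {X : ι → Ω → ℝ}
    (hX : IsGaussianProcess X P) (hmean : ∀ i, ∫ ω, X i ω ∂P = 0) {A B : Ω → ℝ}
    (hA : InClosedSpan X P A) (hB : InClosedSpan X P B) : IsCenteredGaussianPair A B P where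
  left := hA.isCenteredGaussian hX hmean
  right := hB.isCenteredGaussian hX hmean
  add := (hA.add hB).isCenteredGaussian hX hmean
  sub := (hA.sub hB).isCenteredGaussian hX hmean

/-- The solution of the sentiment and volatility equations in terms of two correlated
Ornstein-Uhlenbeck processes. -/
theorem IsSSVSolution.exists_representation [IsProbabilityMeasure P]
    {lam γ μs σs μv β σv ρ S₀ V₀ : ℝ} {Ws Wv S V : ℝ≥0 → Ω → ℝ}
    (h : IsSSVSolution P lam γ μs σs μv β σv ρ S₀ V₀ Ws Wv S V) :
    ∃ Y N : ℝ → Ω → ℝ, IsCorrelatedOU lam γ ρ Y N P ∧ ∀ᵐ ω ∂P, ∀ t : ℝ≥0,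
      S t ω = μs + (Real.exp (-lam * t) * (S₀ - μs) + σs * Y t ω) ∧
      V t ω = Real.exp (-γ * t) * (V₀ + μv * expIntegral γ t) + σv * N t ω +
        β * Real.exp (-γ * t) * ∫ u in (0 : ℝ)..t,
          Real.exp (γ * u) * (Real.exp (-lam * u) * (S₀ - μs) + σs * Y u ω) ^ 2 := by
  obtain ⟨W₁, hm₁, hc₁, he₁⟩ := exists_continuous_measurable_modification
    (fun t => h.noise.brownian_s.toIsPreBrownianReal.aemeasurable t) h.noise.brownian_s.cont
  obtain ⟨W₂, hm₂, hc₂, he₂⟩ := exists_continuous_measurable_modification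
    (fun t => h.noise.brownian_v.toIsPreBrownianReal.aemeasurable t) h.noise.brownian_v.cont
  -- Both Brownian motions form one Gaussian family, so a single closed span contains `Y` and `N`
  -- and makes them jointly Gaussian.
  set X : ℝ≥0 ⊕ ℝ≥0 → Ω → ℝ := Sum.elim Ws Wv with hX
  have hG : IsGaussianProcess X P := h.noise.gaussian
  have hmean : ∀ i, ∫ ω, X i ω ∂P = 0 := by
    rintro (i | i)
    · exact h.noise.brownian_s.toIsPreBrownianReal.integral_eval i
    · exact h.noise.brownian_v.toIsPreBrownianReal.integral_eval i
  have hae₁ : ∀ u, 0 ≤ u → Ws u.toNNReal =ᵐ[P] W₁ u := by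
    intro u hu
    filter_upwards [he₁] with ω hω
    rw [← hω, Real.coe_toNNReal u hu]
  have hae₂ : ∀ u, 0 ≤ u → Wv u.toNNReal =ᵐ[P] W₂ u := by
    intro u hu
    filter_upwards [he₂] with ω hω
    rw [← hω, Real.coe_toNNReal u hu]
  have hsp₁ : ∀ u, 0 ≤ u → InClosedSpan X P (W₁ u) := fun u hu =>
    (InClosedSpan.of_mem (X := X) (i := Sum.inl u.toNNReal)
      (hG.hasGaussianLaw_eval _).memLp_two).congr (hae₁ u hu)
  have hsp₂ : ∀ u, 0 ≤ u → InClosedSpan X P (W₂ u) := fun u hu =>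
    (InClosedSpan.of_mem (X := X) (i := Sum.inr u.toNNReal)
      (hG.hasGaussianLaw_eval _).memLp_two).congr (hae₂ u hu)
  have hmin : ∀ u t : ℝ, 0 ≤ u → 0 ≤ t →
      ((min u.toNNReal t.toNNReal : ℝ≥0) : ℝ) = min u t := by
    intro u t hu ht
    rw [NNReal.coe_min, Real.coe_toNNReal u hu, Real.coe_toNNReal t ht]
  have hcov₁ : ∀ u t, 0 ≤ u → 0 ≤ t → cov[W₁ u, W₁ t; P] = min u t := by
    intro u t hu ht
    rw [← covariance_congr (hae₁ u hu) (hae₁ t ht),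
      h.noise.brownian_s.toIsPreBrownianReal.covariance_eval, ← hmin u t hu ht]
  have hcov₂ : ∀ u t, 0 ≤ u → 0 ≤ t → cov[W₂ u, W₂ t; P] = min u t := by
    intro u t hu ht
    rw [← covariance_congr (hae₂ u hu) (hae₂ t ht),
      h.noise.brownian_v.toIsPreBrownianReal.covariance_eval, ← hmin u t hu ht]
  have hcov₁₂ : ∀ u t, 0 ≤ u → 0 ≤ t → cov[W₁ u, W₂ t; P] = ρ * min u t := by
    intro u t hu ht
    rw [← covariance_congr (hae₁ u hu) (hae₂ t ht), h.noise.cov_eq, ← hmin u t hu ht]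
  have hr₁ := IsRegularProcess.of_covariance hm₁ hc₁
    (fun u hu => (hsp₁ u hu).isCenteredGaussian hG hmean) hcov₁
  have hr₂ := IsRegularProcess.of_covariance hm₂ hc₂
    (fun u hu => (hsp₂ u hu).isCenteredGaussian hG hmean) hcov₂
  refine ⟨ornsteinUhlenbeck lam W₁, ornsteinUhlenbeck γ W₂,
    ⟨hr₁.ornsteinUhlenbeck lam, hr₂.ornsteinUhlenbeck γ, fun s t hs ht => ?_, fun s t hs ht => ?_,
      fun s t hs hst => ?_, fun s t hs hst => ?_, fun t ht => ?_⟩, ?_⟩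
  · exact (InClosedSpan.ornsteinUhlenbeck hr₁ hsp₁ lam hs).isCenteredGaussianPair hG hmean
      (InClosedSpan.ornsteinUhlenbeck hr₁ hsp₁ lam ht)
  · exact (InClosedSpan.ornsteinUhlenbeck hr₁ hsp₁ lam hs).isCenteredGaussianPair hG hmean
      (InClosedSpan.ornsteinUhlenbeck hr₂ hsp₂ γ ht)
  · simpa using covariance_ornsteinUhlenbeck hr₁ hr₁ (ρ := 1) (by simpa using hcov₁) lam lam hs hst
  · exact covariance_ornsteinUhlenbeck hr₁ hr₂ hcov₁₂ lam γ hs hst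
  · simpa using covariance_ornsteinUhlenbeck hr₂ hr₂ (ρ := 1) (by simpa using hcov₂) γ γ ht le_rfl
  filter_upwards [he₁, he₂, h.continuous_S, h.continuous_V, h.eq_S, h.eq_V]
    with ω hω₁ hω₂ hSc hVc hS hV
  have hSreal : Continuous fun u : ℝ => S u.toNNReal ω := hSc.comp continuous_real_toNNReal
  have hVreal : Continuous fun u : ℝ => V u.toNNReal ω := hVc.comp continuous_real_toNNReal
  have hSrep : ∀ t : ℝ, 0 ≤ t → S t.toNNReal ω - μs =
      Real.exp (-lam * t) * (S₀ - μs) + σs * ornsteinUhlenbeck lam W₁ t ω := by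
    intro t ht
    have hw : Continuous fun u => σs * W₁ u ω := continuous_const.mul (hc₁ ω)
    have := linear_equation_solution (a := lam) (x₀ := S₀ - μs)
      (x := fun u => S u.toNNReal ω - μs) (f := fun _ => 0) (hSreal.sub continuous_const)
      continuous_const hw (fun r hr => ?_) ht
    · simp only [mul_zero, intervalIntegral.integral_zero, add_zero] at this
      rw [this, ornsteinUhlenbeck]
      have e : ∫ u in (0 : ℝ)..t, Real.exp (lam * u) * (σs * W₁ u ω) =
          σs * ∫ u in (0 : ℝ)..t, Real.exp (lam * u) * W₁ u ω := by
        rw [← intervalIntegral.integral_const_mul]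
        congr 1; ext u; ring
      rw [e]
      ring
    · have h1 := hS r.toNNReal
      rw [← hω₁, Real.coe_toNNReal r hr] at h1
      have e : ∀ u : ℝ, lam * (μs - S u.toNNReal ω) = 0 - lam * (S u.toNNReal ω - μs) :=
        fun u => by ring
      simp only [e] at h1
      rw [h1]
      ring
  intro t
  refine ⟨?_, ?_⟩
  · have := hSrep t t.2
    rw [Real.toNNReal_coe] at this
    linarith
  · have hw : Continuous fun u => σv * W₂ u ω := continuous_const.mul (hc₂ ω)
    have := linear_equation_solution (a := γ) (x₀ := V₀) (x := fun u => V u.toNNReal ω)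
      (f := fun u => μv + β * (S u.toNNReal ω - μs) ^ 2) hVreal (by fun_prop) hw
      (fun r hr => ?_) t.coe_nonneg
    · simp only [Real.toNNReal_coe] at this
      have e : ∫ u in (0 : ℝ)..t, Real.exp (γ * u) * (σv * W₂ u ω) =
          σv * ∫ u in (0 : ℝ)..t, Real.exp (γ * u) * W₂ u ω := by
        rw [← intervalIntegral.integral_const_mul]
        congr 1; ext u; ring
      have e2 : ∫ u in (0 : ℝ)..t, Real.exp (γ * u) * (μv + β * (S u.toNNReal ω - μs) ^ 2) =
          μv * expIntegral γ t + β * ∫ u in (0 : ℝ)..t, Real.exp (γ * u) *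
            (Real.exp (-lam * u) * (S₀ - μs) + σs * ornsteinUhlenbeck lam W₁ u ω) ^ 2 := by
        have hYc := (hr₁.ornsteinUhlenbeck lam).continuous ω
        rw [expIntegral, ← intervalIntegral.integral_const_mul,
          ← intervalIntegral.integral_const_mul,
          ← intervalIntegral.integral_add (Continuous.intervalIntegrable (by fun_prop) _ _)
            (Continuous.intervalIntegrable (by fun_prop) _ _)]
        refine intervalIntegral.integral_congr fun u hu => ?_
        rw [Set.uIcc_of_le t.coe_nonneg] at hu
        simp only [hSrep u hu.1]
        ring
      rw [e, e2] at this
      rw [this, ornsteinUhlenbeck]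
      ring
    · have h1 := hV r.toNNReal
      rw [← hω₂, Real.coe_toNNReal r hr] at h1
      exact h1

end CorrelatedOrnsteinUhlenbeck

/-! ### Moments of the integrated squared sentiment. -/

section QuadraticFunctional

variable {Ω : Type*} [MeasurableSpace Ω] {P : Measure Ω} {lam γ ρ : ℝ} {Y N : ℝ → Ω → ℝ}

namespace IsCorrelatedOU

/-- The weighted square `exp (γ u) (exp (-lam u) x₀ + σ Yᵤ)²`. -/
noncomputable def weightedSquare (lam γ x₀ σ : ℝ) (Y : ℝ → Ω → ℝ) (u : ℝ) (ω : Ω) : ℝ :=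
  Real.exp (γ * u) * (Real.exp (-lam * u) * x₀ + σ * Y u ω) ^ 2

/-- The time integral of `weightedSquare`. -/
noncomputable def squareIntegral (lam γ x₀ σ : ℝ) (Y : ℝ → Ω → ℝ) (t : ℝ) (ω : Ω) : ℝ :=
  ∫ u in (0 : ℝ)..t, weightedSquare lam γ x₀ σ Y u ω

theorem exp_neg_mul_expIntegral (hlam : lam ≠ 0) (u : ℝ) :
    Real.exp (-lam * u) * Real.exp (-lam * u) * expIntegral (lam + lam) u =
      (1 - Real.exp (-2 * lam * u)) / (2 * lam) := by
  rw [expIntegral_eq (by simpa using hlam), ← Real.exp_add, mul_div_assoc', mul_sub,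
    ← Real.exp_add]
  ring_nf
  simp
  ring

variable [IsProbabilityMeasure P]

theorem regular_weightedSquare (h : IsCorrelatedOU lam γ ρ Y N P) (x₀ σ : ℝ) :
    IsRegularProcess (weightedSquare lam γ x₀ σ Y) P := by
  have hY2 := h.regular_Y.sq_of_isCenteredGaussian fun u hu => (h.pair_YY u u hu hu).left
  have h1 : IsRegularProcess (fun u (_ : Ω) => Real.exp (γ * u) * (Real.exp (-lam * u) * x₀) ^ 2) P :=
    IsRegularProcess.deterministic (by fun_prop)
  have h2 := h.regular_Y.mul_deterministic
    (k := fun u => Real.exp (γ * u) * (2 * (Real.exp (-lam * u) * x₀) * σ)) (by fun_prop)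
  have h3 := hY2.mul_deterministic (k := fun u => Real.exp (γ * u) * σ ^ 2) (by fun_prop)
  have e : weightedSquare lam γ x₀ σ Y = fun u ω =>
      Real.exp (γ * u) * (Real.exp (-lam * u) * x₀) ^ 2 +
        Real.exp (γ * u) * (2 * (Real.exp (-lam * u) * x₀) * σ) * Y u ω +
        Real.exp (γ * u) * σ ^ 2 * Y u ω ^ 2 := by
    ext u ω
    rw [weightedSquare]
    ring
  rw [e]
  exact (h1.add h2).add h3

theorem memLp_squareIntegral (h : IsCorrelatedOU lam γ ρ Y N P) (x₀ σ : ℝ) {t : ℝ} (ht : 0 ≤ t) :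
    MemLp (squareIntegral lam γ x₀ σ Y t) 2 P :=
  ((h.regular_weightedSquare x₀ σ).memLp_integral ht).1

theorem integral_weightedSquare (h : IsCorrelatedOU lam γ ρ Y N P) (x₀ σ : ℝ) {u : ℝ}
    (hu : 0 ≤ u) :
    ∫ ω, weightedSquare lam γ x₀ σ Y u ω ∂P = Real.exp (γ * u) *
      ((Real.exp (-lam * u) * x₀) ^ 2 +
        σ ^ 2 * (Real.exp (-lam * u) * Real.exp (-lam * u) * expIntegral (lam + lam) u)) := by
  have hp := h.pair_YY u u hu hu
  rw [← h.cov_YY u u hu le_rfl, hp.covariance_eq]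
  simp only [weightedSquare]
  rw [integral_const_mul]
  congr 1
  have e : (fun ω => (Real.exp (-lam * u) * x₀ + σ * Y u ω) ^ 2) = fun ω =>
      (Real.exp (-lam * u) * x₀) ^ 2 + (2 * (Real.exp (-lam * u) * x₀) * σ * Y u ω +
        σ ^ 2 * (Y u ω * Y u ω)) := by
    ext ω; ring
  have i1 : Integrable (fun ω => 2 * (Real.exp (-lam * u) * x₀) * σ * Y u ω) P :=
    hp.left.gaussian.integrable.const_mul _
  have i2 : Integrable (fun ω => σ ^ 2 * (Y u ω * Y u ω)) P :=
    (hp.left.integrable_mul hp.right).const_mul _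
  rw [e, integral_add (integrable_const _) (i1.fun_add i2), integral_add i1 i2, integral_const_mul,
    integral_const_mul, hp.left.mean]
  simp

theorem integral_squareIntegral (h : IsCorrelatedOU lam γ ρ Y N P) (hlam : lam ≠ 0) (x₀ σ : ℝ)
    {t : ℝ} (ht : 0 ≤ t) :
    ∫ ω, squareIntegral lam γ x₀ σ Y t ω ∂P =
      (x₀ ^ 2 - σ ^ 2 / (2 * lam)) * expIntegral (γ - 2 * lam) t +
        σ ^ 2 / (2 * lam) * expIntegral γ t := by
  simp only [squareIntegral]
  rw [(h.regular_weightedSquare x₀ σ).integral_integral ht]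
  -- The zero third summand pads the integrand to the shape of `integral_three_exp`.
  have e : Set.EqOn (fun u => ∫ ω, weightedSquare lam γ x₀ σ Y u ω ∂P)
      (fun u => (x₀ ^ 2 - σ ^ 2 / (2 * lam)) * Real.exp ((γ - 2 * lam) * u) +
        σ ^ 2 / (2 * lam) * Real.exp (γ * u) + 0 * Real.exp (0 * u)) (Set.uIcc 0 t) := by
    intro u hu
    rw [Set.uIcc_of_le ht] at hu
    simp only
    rw [h.integral_weightedSquare x₀ σ hu.1, exp_neg_mul_expIntegral hlam, mul_pow,
      ← Real.exp_nat_mul, show (γ - 2 * lam) * u = γ * u + -2 * lam * u by ring, Real.exp_add]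
    push_cast
    ring_nf
  rw [intervalIntegral.integral_congr e, integral_three_exp]
  ring

theorem covariance_squareIntegral_Y (h : IsCorrelatedOU lam γ ρ Y N P) (hlam : lam ≠ 0)
    (x₀ σ : ℝ) {t : ℝ} (ht : 0 ≤ t) :
    cov[Y t, squareIntegral lam γ x₀ σ Y t; P] =
      x₀ * σ / lam * Real.exp (-lam * t) * (expIntegral γ t - expIntegral (γ - 2 * lam) t) := by
  unfold squareIntegral
  rw [(h.regular_weightedSquare x₀ σ).covariance_integral ht (h.regular_Y.memLp ht)]
  have e : Set.EqOn (fun u => cov[Y t, weightedSquare lam γ x₀ σ Y u; P])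
      (fun u => x₀ * σ / lam * Real.exp (-lam * t) * Real.exp (γ * u) +
        -(x₀ * σ / lam * Real.exp (-lam * t)) * Real.exp ((γ - 2 * lam) * u) +
          0 * Real.exp (0 * u)) (Set.uIcc 0 t) := by
    intro u hu
    rw [Set.uIcc_of_le ht] at hu
    unfold weightedSquare
    simp only
    rw [covariance_const_mul_right, (h.pair_YY u t hu.1 ht).covariance_affine_sq,
      h.cov_YY u t hu.1 hu.2]
    have := exp_neg_mul_expIntegral hlam u
    rw [show (γ - 2 * lam) * u = γ * u + -2 * lam * u by ring, Real.exp_add]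
    linear_combination (Real.exp (γ * u) * 2 * x₀ * σ * Real.exp (-lam * t)) * this
  rw [intervalIntegral.integral_congr e, integral_three_exp]
  ring

/-- Only the part of the square linear in `Y u` correlates with `N t`. As `u ≤ t`, the covariance is
needed only with `Y` at the earlier time. -/
theorem covariance_squareIntegral_N (h : IsCorrelatedOU lam γ ρ Y N P) (hlg : lam + γ ≠ 0)
    (x₀ σ : ℝ) {t : ℝ} (ht : 0 ≤ t) :
    cov[N t, squareIntegral lam γ x₀ σ Y t; P] =
      2 * x₀ * σ * ρ * Real.exp (-γ * t) / (lam + γ) *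
        (expIntegral (2 * γ - lam) t - expIntegral (γ - 2 * lam) t) := by
  unfold squareIntegral
  rw [(h.regular_weightedSquare x₀ σ).covariance_integral ht (h.regular_N.memLp ht)]
  have e : Set.EqOn (fun u => cov[N t, weightedSquare lam γ x₀ σ Y u; P])
      (fun u => 2 * x₀ * σ * ρ * Real.exp (-γ * t) / (lam + γ) * Real.exp ((2 * γ - lam) * u) +
        -(2 * x₀ * σ * ρ * Real.exp (-γ * t) / (lam + γ)) * Real.exp ((γ - 2 * lam) * u) +
          0 * Real.exp (0 * u)) (Set.uIcc 0 t) := by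
    intro u hu
    rw [Set.uIcc_of_le ht] at hu
    unfold weightedSquare
    simp only
    rw [covariance_const_mul_right, (h.pair_YN u t hu.1 ht).covariance_affine_sq,
      h.cov_YN u t hu.1 hu.2, expIntegral_eq hlg,
      show (γ - 2 * lam) * u = γ * u + -lam * u + -lam * u by ring,
      show (2 * γ - lam) * u = γ * u + -lam * u + -lam * u + (lam + γ) * u by ring]
    simp only [Real.exp_add]
    ring
  rw [intervalIntegral.integral_congr e, integral_three_exp]
  ring

/-- Both `m r` and `Cov(Y u, Y r)` depend on the later time `r` only through a factor `exp (-lam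
r)`. The two terms of the quadratic covariance therefore share the factor `exp (-2 lam r)`, and the
kernel factors as `integral_symm_kernel_square` requires. -/
theorem covariance_weightedSquare (h : IsCorrelatedOU lam γ ρ Y N P) (hlam : lam ≠ 0)
    (x₀ σ : ℝ) {u r : ℝ} (hu : 0 ≤ u) (hur : u ≤ r) :
    cov[weightedSquare lam γ x₀ σ Y u, weightedSquare lam γ x₀ σ Y r; P] =
      (σ ^ 4 / (2 * lam ^ 2) * Real.exp ((γ + 2 * lam) * u) +
        (2 * x₀ ^ 2 * σ ^ 2 / lam - σ ^ 4 / lam ^ 2) * Real.exp (γ * u) +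
        (σ ^ 4 / (2 * lam ^ 2) - 2 * x₀ ^ 2 * σ ^ 2 / lam) * Real.exp ((γ - 2 * lam) * u)) *
          Real.exp ((γ - 2 * lam) * r) := by
  have hr := hu.trans hur
  unfold weightedSquare
  rw [covariance_const_mul_right, covariance_const_mul_left,
    (h.pair_YY u r hu hr).covariance_affine_sq_affine_sq, h.cov_YY u r hu hur,
    expIntegral_eq (by simpa using hlam)]
  rw [show (γ - 2 * lam) * u = γ * u + -lam * u + -lam * u by ring,
    show (γ - 2 * lam) * r = γ * r + -lam * r + -lam * r by ring,
    show (γ + 2 * lam) * u = γ * u + lam * u + lam * u by ring,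
    show (lam + lam) * u = lam * u + lam * u by ring]
  simp only [Real.exp_add]
  have hp : Real.exp (-lam * u) = (Real.exp (lam * u))⁻¹ := by rw [← Real.exp_neg]; ring_nf
  have hne := (Real.exp_pos (lam * u)).ne'
  rw [hp]
  field_simp
  ring

theorem covariance_squareIntegral_self (h : IsCorrelatedOU lam γ ρ Y N P) (hlam : lam ≠ 0)
    (hγ : γ ≠ 0) (h₁ : γ + 2 * lam ≠ 0) (h₂ : γ - 2 * lam ≠ 0) (x₀ σ : ℝ) {t : ℝ} (ht : 0 ≤ t) :
    cov[squareIntegral lam γ x₀ σ Y t, squareIntegral lam γ x₀ σ Y t; P] =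
      2 * (σ ^ 4 / (2 * lam ^ 2) *
          ((expIntegral (2 * γ) t - expIntegral (γ - 2 * lam) t) / (γ + 2 * lam)) +
        (2 * x₀ ^ 2 * σ ^ 2 / lam - σ ^ 4 / lam ^ 2) *
          ((expIntegral (2 * γ - 2 * lam) t - expIntegral (γ - 2 * lam) t) / γ) +
        (σ ^ 4 / (2 * lam ^ 2) - 2 * x₀ ^ 2 * σ ^ 2 / lam) *
          ((expIntegral (2 * γ - 4 * lam) t - expIntegral (γ - 2 * lam) t) / (γ - 2 * lam))) := by
  have hreg := h.regular_weightedSquare x₀ σ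
  have hJ := h.memLp_squareIntegral x₀ σ ht
  have e1 : cov[squareIntegral lam γ x₀ σ Y t, squareIntegral lam γ x₀ σ Y t; P] =
      ∫ r in (0 : ℝ)..t, ∫ u in (0 : ℝ)..t,
        cov[weightedSquare lam γ x₀ σ Y u, weightedSquare lam γ x₀ σ Y r; P] := by
    have := hreg.covariance_integral ht hJ
    refine this.trans (intervalIntegral.integral_congr fun r hr => ?_)
    rw [Set.uIcc_of_le ht] at hr
    refine (covariance_comm _ _).trans ?_
    refine (hreg.covariance_integral ht (hreg.memLp hr.1)).trans ?_
    simp only [covariance_comm (weightedSquare lam γ x₀ σ Y r)]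
  have e3 := integral_symm_kernel_square
    (F := fun u r => cov[weightedSquare lam γ x₀ σ Y u, weightedSquare lam γ x₀ σ Y r; P])
    (α := fun u => σ ^ 4 / (2 * lam ^ 2) * Real.exp ((γ + 2 * lam) * u) +
        (2 * x₀ ^ 2 * σ ^ 2 / lam - σ ^ 4 / lam ^ 2) * Real.exp (γ * u) +
        (σ ^ 4 / (2 * lam ^ 2) - 2 * x₀ ^ 2 * σ ^ 2 / lam) * Real.exp ((γ - 2 * lam) * u))
    (ψ := fun r => Real.exp ((γ - 2 * lam) * r)) (by fun_prop) (by fun_prop)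
    (fun u r hu hur => h.covariance_weightedSquare hlam x₀ σ hu hur)
    (fun u r => covariance_comm (weightedSquare lam γ x₀ σ Y u) (weightedSquare lam γ x₀ σ Y r)) ht
  rw [e1, e3]
  simp only [integral_three_exp]
  congr 1
  have e2 : ∀ a b c r : ℝ, Real.exp ((γ - 2 * lam) * r) * (a * expIntegral (γ + 2 * lam) r +
      b * expIntegral γ r + c * expIntegral (γ - 2 * lam) r) =
      a * (Real.exp ((γ - 2 * lam) * r) * expIntegral (γ + 2 * lam) r) +
      b * (Real.exp ((γ - 2 * lam) * r) * expIntegral γ r) +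
      c * (Real.exp ((γ - 2 * lam) * r) * expIntegral (γ - 2 * lam) r) := fun a b c r => by ring
  simp only [e2]
  rw [intervalIntegral.integral_add (Continuous.intervalIntegrable (by fun_prop) _ _)
    (Continuous.intervalIntegrable (by fun_prop) _ _),
    intervalIntegral.integral_add (Continuous.intervalIntegrable (by fun_prop) _ _)
    (Continuous.intervalIntegrable (by fun_prop) _ _), intervalIntegral.integral_const_mul,
    intervalIntegral.integral_const_mul, intervalIntegral.integral_const_mul,
    integral_exp_mul_expIntegral h₁, integral_exp_mul_expIntegral hγ,
    integral_exp_mul_expIntegral h₂]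
  ring_nf

end IsCorrelatedOU

end QuadraticFunctional

/-! ### Algebraic reduction to the stated closed forms. -/

section ClosedForms

/-- The mean of the volatility in closed form. -/
theorem ssv_mean_closed_form {lam γ : ℝ} (μs σs μv β S₀ V₀ t : ℝ) (hγ : γ ≠ 0) (hlam : lam ≠ 0)
    (h₂ : γ - 2 * lam ≠ 0) :
    Real.exp (-γ * t) * (V₀ + μv * expIntegral γ t) + β * Real.exp (-γ * t) *
      (((S₀ - μs) ^ 2 - σs ^ 2 / (2 * lam)) * expIntegral (γ - 2 * lam) t +
        σs ^ 2 / (2 * lam) * expIntegral γ t) =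
        Real.exp (-(γ + 2 * lam) * t) / (2 * γ * lam * (γ - 2 * lam)) *
          (β * γ * Real.exp (γ * t) *
              (2 * lam * μs ^ 2 + 2 * lam * S₀ ^ 2 - 4 * lam * μs * S₀ - σs ^ 2)
            - 2 * lam * Real.exp (2 * lam * t) *
              (β * γ * μs ^ 2 - β * σs ^ 2 + γ * μv - 2 * lam * μv + β * γ * S₀ ^ 2
                - 2 * β * γ * μs * S₀ - γ * V₀ * (γ - 2 * lam))
            + (γ - 2 * lam) * Real.exp ((γ + 2 * lam) * t) * (β * σs ^ 2 + 2 * lam * μv)) := by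
  rw [expIntegral_eq hγ, expIntegral_eq h₂]
  rw [show -γ * t = -(γ * t) by ring, show -(γ + 2 * lam) * t = -(γ * t + lam * t + lam * t) by ring,
    show (γ - 2 * lam) * t = γ * t + -(lam * t) + -(lam * t) by ring,
    show 2 * lam * t = lam * t + lam * t by ring,
    show (γ + 2 * lam) * t = γ * t + lam * t + lam * t by ring]
  simp only [Real.exp_add, Real.exp_neg]
  have hG := (Real.exp_pos (γ * t)).ne'
  have hL := (Real.exp_pos (lam * t)).ne'
  -- Every exponential is now a Laurent monomial in `G` and `L`, so the claim is an identity of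
  -- rational functions.
  generalize Real.exp (γ * t) = G at *
  generalize Real.exp (lam * t) = L at *
  field_simp
  ring

/-- The covariance of sentiment and volatility in closed form. -/
theorem ssv_cov_closed_form {lam γ : ℝ} (μs σs β σv ρ S₀ t : ℝ) (hγ : γ ≠ 0) (hlam : lam ≠ 0)
    (h₂ : γ - 2 * lam ≠ 0) (h₃ : lam + γ ≠ 0) :
    σs * (σv * (ρ * (Real.exp (-lam * t) * Real.exp (-γ * t) * expIntegral (lam + γ) t)) +
      β * Real.exp (-γ * t) * ((S₀ - μs) * σs / lam * Real.exp (-lam * t) *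
        (expIntegral γ t - expIntegral (γ - 2 * lam) t))) =
        σs * Real.exp (-(γ + 3 * lam) * t) / (γ * lam * (γ - 2 * lam) * (γ + lam)) *
          (β * σs * (γ ^ 2 - γ * lam - 2 * lam ^ 2) * (S₀ - μs) * Real.exp ((γ + 2 * lam) * t)
            + lam * Real.exp (2 * lam * t) *
              (-2 * β * μs * σs * (γ + lam) - γ * ρ * σv * (γ - 2 * lam)
                + 2 * β * S₀ * σs * (γ + lam))
            - β * γ * σs * (γ + lam) * (S₀ - μs) * Real.exp (γ * t)
            + γ * lam * ρ * σv * (γ - 2 * lam) * Real.exp ((γ + 3 * lam) * t)) := by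
  have h₄ : γ + lam ≠ 0 := by rwa [add_comm]
  rw [expIntegral_eq hγ, expIntegral_eq h₂, expIntegral_eq h₃, add_comm lam γ]
  rw [show -γ * t = -(γ * t) by ring, show -lam * t = -(lam * t) by ring,
    show -(γ + 3 * lam) * t = -(γ * t + lam * t + lam * t + lam * t) by ring,
    show (γ - 2 * lam) * t = γ * t + -(lam * t) + -(lam * t) by ring,
    show 2 * lam * t = lam * t + lam * t by ring, show (γ + lam) * t = γ * t + lam * t by ring,
    show (γ + 2 * lam) * t = γ * t + lam * t + lam * t by ring,
    show (γ + 3 * lam) * t = γ * t + lam * t + lam * t + lam * t by ring]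
  simp only [Real.exp_add, Real.exp_neg]
  have hG := (Real.exp_pos (γ * t)).ne'
  have hL := (Real.exp_pos (lam * t)).ne'
  generalize Real.exp (γ * t) = G at *
  generalize Real.exp (lam * t) = L at *
  -- The denominators become atoms while fractions are cleared, and are substituted back for the
  -- final polynomial identity.
  generalize hd₂ : γ - 2 * lam = d₂ at *
  generalize hd₃ : γ + lam = d₃ at *
  field_simp
  subst hd₂ hd₃
  ring

/-- The variance of the volatility in closed form. -/
theorem ssv_variance_closed_form {lam γ : ℝ} (μs σs β σv ρ S₀ t : ℝ) (hγ : γ ≠ 0) (hlam : lam ≠ 0)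
    (h₂ : γ - 2 * lam ≠ 0) (h₁ : γ - lam ≠ 0) (h₅ : 2 * γ - lam ≠ 0) (h₃ : γ + lam ≠ 0)
    (h₄ : γ + 2 * lam ≠ 0) :
    σv ^ 2 * (Real.exp (-γ * t) * Real.exp (-γ * t) * expIntegral (γ + γ) t) +
      2 * (σv * (β * Real.exp (-γ * t)) *
        (2 * (S₀ - μs) * σs * ρ * Real.exp (-γ * t) / (lam + γ) *
          (expIntegral (2 * γ - lam) t - expIntegral (γ - 2 * lam) t))) +
      (β * Real.exp (-γ * t)) ^ 2 *
        (2 * (σs ^ 4 / (2 * lam ^ 2) *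
          ((expIntegral (2 * γ) t - expIntegral (γ - 2 * lam) t) / (γ + 2 * lam)) +
        (2 * (S₀ - μs) ^ 2 * σs ^ 2 / lam - σs ^ 4 / lam ^ 2) *
          ((expIntegral (2 * γ - 2 * lam) t - expIntegral (γ - 2 * lam) t) / γ) +
        (σs ^ 4 / (2 * lam ^ 2) - 2 * (S₀ - μs) ^ 2 * σs ^ 2 / lam) *
          ((expIntegral (2 * γ - 4 * lam) t - expIntegral (γ - 2 * lam) t) / (γ - 2 * lam)))) =
        Real.exp (-2 * (γ + 2 * lam) * t) /
          (2 * γ * lam ^ 2 * (γ - 2 * lam) ^ 2 * (γ - lam) * (2 * γ - lam) * (γ + lam) *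
            (γ + 2 * lam)) *
          (-ssvA lam γ μs σs β σv ρ S₀ t + ssvB lam γ μs σs β S₀ t - ssvC lam γ μs σs β S₀ t
            - ssvD lam γ μs σs β σv ρ S₀ t + ssvE lam γ μs σs β σv ρ S₀ t
            + ssvF lam γ σs β σv t) := by
  have e₁ : 2 * γ - 2 * lam = 2 * (γ - lam) := by ring
  have e₂ : 2 * γ - 4 * lam = 2 * (γ - 2 * lam) := by ring
  rw [add_comm lam γ, ← two_mul γ, e₁, e₂, expIntegral_eq h₂, expIntegral_eq h₅,
    expIntegral_eq (mul_ne_zero two_ne_zero hγ), expIntegral_eq (mul_ne_zero two_ne_zero h₁),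
    expIntegral_eq (mul_ne_zero two_ne_zero h₂)]
  unfold ssvA ssvB ssvC ssvD ssvE ssvF
  have hG := (Real.exp_pos (γ * t)).ne'
  have hL := (Real.exp_pos (lam * t)).ne'
  -- `i, j` are the exponents of `exp (γ t)` and `exp (lam t)` in the numerator, `k, l` those in the
  -- denominator.
  have hpow : ∀ (i j k l : ℕ) {c : ℝ}, c = i * (γ * t) + j * (lam * t) - (k * (γ * t) + l * (lam * t)) →
      Real.exp c = Real.exp (γ * t) ^ i * Real.exp (lam * t) ^ j /
        (Real.exp (γ * t) ^ k * Real.exp (lam * t) ^ l) := by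
    rintro i j k l c rfl
    simp only [Real.exp_sub, Real.exp_add, Real.exp_nat_mul]
  rw [hpow 0 0 1 0 (c := -γ * t) (by push_cast; ring),
    hpow 2 0 0 0 (c := 2 * γ * t) (by push_cast; ring),
    hpow 2 0 0 1 (c := (2 * γ - lam) * t) (by push_cast; ring),
    hpow 1 0 0 2 (c := (γ - 2 * lam) * t) (by push_cast; ring),
    hpow 2 0 0 2 (c := 2 * (γ - lam) * t) (by push_cast; ring),
    hpow 2 0 0 4 (c := 2 * (γ - 2 * lam) * t) (by push_cast; ring),
    hpow 0 0 2 4 (c := -2 * (γ + 2 * lam) * t) (by push_cast; ring),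
    hpow 0 4 0 0 (c := 4 * lam * t) (by push_cast; ring),
    hpow 2 2 0 0 (c := 2 * (γ + lam) * t) (by push_cast; ring),
    hpow 1 2 0 0 (c := (γ + 2 * lam) * t) (by push_cast; ring),
    hpow 2 3 0 0 (c := (2 * γ + 3 * lam) * t) (by push_cast; ring),
    hpow 2 4 0 0 (c := 2 * (γ + 2 * lam) * t) (by push_cast; ring)]
  simp only [pow_zero, pow_one, one_mul, mul_one, div_one]
  generalize Real.exp (γ * t) = G at *
  generalize Real.exp (lam * t) = L at *
  clear hpow e₁ e₂
  generalize hd₁ : γ - lam = d₁ at *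
  generalize hd₂ : γ - 2 * lam = d₂ at *
  generalize hd₃ : γ + lam = d₃ at *
  generalize hd₄ : γ + 2 * lam = d₄ at *
  generalize hd₅ : 2 * γ - lam = d₅ at *
  field_simp
  subst hd₁ hd₂ hd₃ hd₄ hd₅
  ring

end ClosedForms

/-! ### Moments of affine combinations of two variables. -/

section LinearCombination

variable {Ω : Type*} [MeasurableSpace Ω] {P : Measure Ω} [IsProbabilityMeasure P]
  {Z A B : Ω → ℝ}

theorem covariance_affine_right (hZ : MemLp Z 2 P) (hA : MemLp A 2 P) (hB : MemLp B 2 P)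
    (v a b : ℝ) :
    cov[Z, fun ω => v + (a * A ω + b * B ω); P] = a * cov[Z, A; P] + b * cov[Z, B; P] := by
  have hi : MemLp (fun ω => a * A ω + b * B ω) 2 P := (hA.const_mul a).add (hB.const_mul b)
  rw [covariance_const_add_right (hi.integrable (by norm_num)),
    covariance_fun_add_right hZ (hA.const_mul a) (hB.const_mul b), covariance_const_mul_right,
    covariance_const_mul_right]

theorem memLp_affine (hA : MemLp A 2 P) (hB : MemLp B 2 P) (v a b : ℝ) :
    MemLp (fun ω => v + (a * A ω + b * B ω)) 2 P :=
  (memLp_const v).add ((hA.const_mul a).add (hB.const_mul b))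

theorem integral_affine (hA : MemLp A 2 P) (hB : MemLp B 2 P) (v a b : ℝ) :
    ∫ ω, (v + (a * A ω + b * B ω)) ∂P = v + (a * (∫ ω, A ω ∂P) + b * ∫ ω, B ω ∂P) := by
  have iA := (hA.integrable (by norm_num)).const_mul a
  have iB := (hB.integrable (by norm_num)).const_mul b
  rw [integral_add (integrable_const _) (iA.fun_add iB), integral_add iA iB, integral_const_mul,
    integral_const_mul]
  simp

theorem variance_affine (hA : MemLp A 2 P) (hB : MemLp B 2 P) (v a b : ℝ) :
    variance (fun ω => v + (a * A ω + b * B ω)) P =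
      a ^ 2 * cov[A, A; P] + 2 * (a * b * cov[A, B; P]) + b ^ 2 * cov[B, B; P] := by
  have hi := memLp_affine hA hB v a b
  rw [← covariance_self hi.aestronglyMeasurable.aemeasurable, covariance_affine_right hi hA hB,
    covariance_comm _ A, covariance_comm _ B, covariance_affine_right hA hA hB,
    covariance_affine_right hB hA hB, covariance_comm B A]
  ring

end LinearCombination

/-! ### Assembly of the moment formulas. -/

theorem theorem1 {Ω : Type*} [MeasurableSpace Ω] (P : Measure Ω) [IsProbabilityMeasure P]
    (lam γ μs σs μv β σv ρ S₀ V₀ : ℝ) (Ws Wv S V : ℝ≥0 → Ω → ℝ)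
    (h : IsSSVSolution P lam γ μs σs μv β σv ρ S₀ V₀ Ws Wv S V) (t : ℝ≥0) :
    MemLp (S t) 2 P ∧ MemLp (V t) 2 P ∧
    ∫ ω, S t ω ∂P = Real.exp (-lam * t) * (S₀ + μs * (Real.exp (lam * t) - 1)) ∧
    (γ ≠ 0 → lam ≠ 0 → γ ≠ 2 * lam →
      ∫ ω, V t ω ∂P =
        Real.exp (-(γ + 2 * lam) * t) / (2 * γ * lam * (γ - 2 * lam)) *
          (β * γ * Real.exp (γ * t) *
              (2 * lam * μs ^ 2 + 2 * lam * S₀ ^ 2 - 4 * lam * μs * S₀ - σs ^ 2)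
            - 2 * lam * Real.exp (2 * lam * t) *
              (β * γ * μs ^ 2 - β * σs ^ 2 + γ * μv - 2 * lam * μv + β * γ * S₀ ^ 2
                - 2 * β * γ * μs * S₀ - γ * V₀ * (γ - 2 * lam))
            + (γ - 2 * lam) * Real.exp ((γ + 2 * lam) * t) * (β * σs ^ 2 + 2 * lam * μv))) ∧
    (lam ≠ 0 →
      variance (S t) P =
        σs ^ 2 * Real.exp (-2 * lam * t) * (Real.exp (2 * lam * t) - 1) / (2 * lam)) ∧
    (γ ≠ 0 → lam ≠ 0 → γ ≠ 2 * lam → γ ≠ lam → 2 * γ ≠ lam → γ + lam ≠ 0 → γ + 2 * lam ≠ 0 →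
      variance (V t) P =
        Real.exp (-2 * (γ + 2 * lam) * t) /
          (2 * γ * lam ^ 2 * (γ - 2 * lam) ^ 2 * (γ - lam) * (2 * γ - lam) * (γ + lam) *
            (γ + 2 * lam)) *
          (-ssvA lam γ μs σs β σv ρ S₀ t + ssvB lam γ μs σs β S₀ t - ssvC lam γ μs σs β S₀ t
            - ssvD lam γ μs σs β σv ρ S₀ t + ssvE lam γ μs σs β σv ρ S₀ t
            + ssvF lam γ σs β σv t)) ∧
    (γ ≠ 0 → lam ≠ 0 → γ ≠ 2 * lam → γ + lam ≠ 0 →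
      cov[S t, V t; P] =
        σs * Real.exp (-(γ + 3 * lam) * t) / (γ * lam * (γ - 2 * lam) * (γ + lam)) *
          (β * σs * (γ ^ 2 - γ * lam - 2 * lam ^ 2) * (S₀ - μs) * Real.exp ((γ + 2 * lam) * t)
            + lam * Real.exp (2 * lam * t) *
              (-2 * β * μs * σs * (γ + lam) - γ * ρ * σv * (γ - 2 * lam)
                + 2 * β * S₀ * σs * (γ + lam))
            - β * γ * σs * (γ + lam) * (S₀ - μs) * Real.exp (γ * t)
            + γ * lam * ρ * σv * (γ - 2 * lam) * Real.exp ((γ + 3 * lam) * t))) := by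
  obtain ⟨Y, N, hYN, hrep⟩ := h.exists_representation
  have ht : (0 : ℝ) ≤ t := t.coe_nonneg
  set J := IsCorrelatedOU.squareIntegral lam γ (S₀ - μs) σs Y t with hJ
  set s₀ := μs + Real.exp (-lam * t) * (S₀ - μs) with hs₀
  set v₀ := Real.exp (-γ * t) * (V₀ + μv * expIntegral γ t) with hv₀
  set κ := β * Real.exp (-γ * t) with hκ
  -- The term `0 * N t ω` lets the lemmas on affine combinations of two variables apply to `S t` as
  -- well.
  have hS : S t =ᵐ[P] fun ω => s₀ + (σs * Y t ω + 0 * N t ω) := by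
    filter_upwards [hrep] with ω hω
    rw [(hω t).1]
    ring
  have hV : V t =ᵐ[P] fun ω => v₀ + (σv * N t ω + κ * J ω) := by
    filter_upwards [hrep] with ω hω
    rw [(hω t).2, add_assoc]
    rfl
  have mY := hYN.regular_Y.memLp ht
  have mN := hYN.regular_N.memLp ht
  have mJ : MemLp J 2 P := hYN.memLp_squareIntegral (S₀ - μs) σs ht
  have pYY := hYN.pair_YY t t ht ht
  have pYN := hYN.pair_YN t t ht ht
  refine ⟨(memLp_congr_ae hS).2 (memLp_affine mY mN _ _ _),
    (memLp_congr_ae hV).2 (memLp_affine mN mJ _ _ _), ?_, ?_, ?_, ?_, ?_⟩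
  · rw [integral_congr_ae hS, integral_affine mY mN, pYY.left.mean, hs₀]
    have he : Real.exp (-lam * t) * Real.exp (lam * t) = 1 := by rw [← Real.exp_add]; simp
    linear_combination (-μs) * he
  · intro hγ hlam h₂
    rw [integral_congr_ae hV, integral_affine mN mJ, pYN.right.mean, hJ,
      hYN.integral_squareIntegral hlam _ _ ht, mul_zero, zero_add]
    exact ssv_mean_closed_form μs σs μv β S₀ V₀ t hγ hlam (sub_ne_zero.2 h₂)
  · intro hlam
    rw [variance_congr hS, variance_affine mY mN, hYN.cov_YY t t ht le_rfl,
      IsCorrelatedOU.exp_neg_mul_expIntegral hlam]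
    have he : Real.exp (-2 * lam * t) * Real.exp (2 * lam * t) = 1 := by
      rw [← Real.exp_add]; ring_nf; simp
    linear_combination (-σs ^ 2 / (2 * lam)) * he
  · intro hγ hlam h₂ h₁ h₅ h₃ h₄
    rw [variance_congr hV, variance_affine mN mJ, hYN.cov_NN t ht, hJ,
      hYN.covariance_squareIntegral_N (by rwa [add_comm]) _ _ ht,
      hYN.covariance_squareIntegral_self hlam hγ h₄ (sub_ne_zero.2 h₂) _ _ ht]
    exact ssv_variance_closed_form μs σs β σv ρ S₀ t hγ hlam (sub_ne_zero.2 h₂)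
      (sub_ne_zero.2 h₁) (sub_ne_zero.2 h₅) h₃ h₄
  · intro hγ hlam h₂ h₃
    rw [covariance_congr hS hV, covariance_comm,
      covariance_affine_right (memLp_affine mN mJ _ _ _) mY mN, covariance_comm _ (Y t),
      covariance_affine_right mY mN mJ, hYN.cov_YN t t ht le_rfl, hJ,
      hYN.covariance_squareIntegral_Y hlam _ _ ht, zero_mul, add_zero]
    exact ssv_cov_closed_form μs σs β σv ρ S₀ t hγ hlam (sub_ne_zero.2 h₂) (by rwa [add_comm])
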